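/- Let $m\ge 0$, $0<\delta<1$ and $\mu>0$. Let $\Omega=D^*(\mathbb R,\mathbb R^m)$ be the space of functions $\omega:\mathbb R\to\mathbb R^m$ that are càdlàg on $[0,\infty)$ and càglàd on $(-\infty,0]$, with the $\sigma$-algebra generated by the evaluations $\omega\mapsto\omega(t)$, and let $\hat L_t(\omega)=\omega(t)$. Let $P$ be a probability measure on $\Omega$ under which $\hat L$ is a two-sided Lévy process without jumps larger than $\delta$: $(\hat L_t)_{t\ge0}$ and $(\hat L_{-t})_{t\ge 0}$ both start at $0$ a.s. and have independent and stationary increments, and for $t\ge 0$, $z\in\mathbb R^m$ $$E\,e^{i\langle z,\hat L_t\rangle}=e^{t\Psi(z)},\qquad E\,e^{i\langle z,\hat L_{-t}\rangle}=e^{t\Psi^-(z)},$$ $$\Psi(z)=-\tfrac12\langle z,AA^{T}z\rangle+i\langle z,b\rangle+\int_{|u|\le\delta}\big(e^{i\langle z,u\rangle}-1-i\langle z,u\rangle\big)\,\nu(du),$$ and $\Psi^-$ is of the same form with data $b^-,A^-,\nu^-$. Here $b,b^-\in\mathbb R^m$, $A,A^-$ are real matrices with $m$ rows, and $\nu,\nu^-$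 are Lévy measures (no mass at $0$, $\int(|u|^2\wedge1)\,d\nu<\infty$) with no mass on $\{|u|>\delta\}$. No relation between the two halves is assumed. For a path $w:\mathbb R\to\mathbb R^m$ put $$Z_t(w)=e^{-\mu t}\int_{-\infty}^t e^{\mu s}\,dw(s),$$ where $\int_a^t e^{\mu s}\,dw(s)$ is the limit of the sums $\sum_i e^{\mu\xi_i}\big(w(t_{i+1})-w(t_i)\big)$, $\xi_i\in[t_i,t_{i+1}]$, over partitions of $[a,t]$ as the mesh tends to $0$, and $\int_{-\infty}^t=\lim_{a\to-\infty}\int_a^t$. Let $(\theta_s w)(u)=w(s+u)-w(s)$. Then: (0) For $P$-almost every $\omega$ the integral $\int_{-\infty}^t e^{\mu s}\,d\hat L_s(\omega)$ exists for all $t\in\mathbb R$. For every $t$ it is also the stochastic integral $\int_{-\infty}^te^{\mu s}\,d\hat L_s$, that is, the limit in probability as $a\to-\infty$ of the limits in probability of the above sums over partitions of $[a,t]$. (i) $dZ_t=-\mu Z_t\,dt+d\hat L_t$ on $\mathbb R$: for $P$-almost every $\omega$ and all $s\le t$ in $\mathbb R$, $r\mapsto Z_r(\omega)$ is integrable on $[s,t]$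 and $$Z_t(\omega)-Z_s(\omega)=-\mu\int_s^t Z_r(\omega)\,dr+\hat L_t(\omega)-\hat L_s(\omega).$$ (ii) For $P$-almost every $\omega$ and all $s,t\in\mathbb R$, the integral that defines $Z_t(\theta_s\omega)$ exists and $Z_{s+t}(\omega)=Z_t(\theta_s\omega)$. -/

import Mathlib

open MeasureTheory ProbabilityTheory Filter Topology Set
open scoped NNReal ENNReal

/-! ### Path space and shift -/

/-- Càdlàg (right continuous with left limits) for `t ≥ 0`, and càglàd (left continuous with
right limits) for `t ≤ 0`; at `t = 0` only the sides inside the respective half-line matter. -/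
def IsTwoSidedPath {m : ℕ} (w : ℝ → EuclideanSpace ℝ (Fin m)) : Prop :=
  (∀ t : ℝ, 0 ≤ t → ContinuousWithinAt w (Ici t) t) ∧
  (∀ t : ℝ, 0 < t → ∃ l, Tendsto w (𝓝[<] t) (𝓝 l)) ∧
  (∀ t : ℝ, t ≤ 0 → ContinuousWithinAt w (Iic t) t) ∧
  (∀ t : ℝ, t < 0 → ∃ l, Tendsto w (𝓝[>] t) (𝓝 l))

/-- The canonical sample space `D*(ℝ, ℝᵐ)`. As a subtype of a function space it carries the
σ-algebra generated by the evaluations `w ↦ w t`, `t ∈ ℝ`. -/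
abbrev PathSpace (m : ℕ) : Type :=
  {w : ℝ → EuclideanSpace ℝ (Fin m) // IsTwoSidedPath w}

/-- The canonical process `L_t(w) = w(t)`. -/
def canonicalProcess {m : ℕ} (t : ℝ) (w : PathSpace m) : EuclideanSpace ℝ (Fin m) := w.1 t

/-- The Wiener shift `(θ_s w)(u) = w(s + u) - w(s)` on paths. -/
def wienerShift {m : ℕ} (s : ℝ) (w : ℝ → EuclideanSpace ℝ (Fin m)) :
    ℝ → EuclideanSpace ℝ (Fin m) :=
  fun u => w (s + u) - w s

/-! ### Lévy processes -/

/-- A process `X` indexed by `[0, ∞)` is a Lévy process: it starts at `0`, has independent and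
stationary increments, and càdlàg paths. -/
structure IsLevyProcess {Ω : Type*} [MeasurableSpace Ω] {m : ℕ}
    (X : ℝ≥0 → Ω → EuclideanSpace ℝ (Fin m)) (P : Measure Ω) : Prop where
  aemeasurable : ∀ t, AEMeasurable (X t) P
  start : ∀ᵐ w ∂P, X 0 w = 0
  indep : HasIndepIncrements X P
  stationary : ∀ s u h : ℝ≥0,
    IdentDistrib (fun w => X (s + h) w - X s w) (fun w => X (u + h) w - X u w) P P
  cadlag : ∀ᵐ w ∂P, ∀ t : ℝ≥0,
    ContinuousWithinAt (fun r => X r w) (Ici t) t ∧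
      ∃ l, Tendsto (fun r => X r w) (𝓝[<] t) (𝓝 l)

/-- `ν` is a Lévy measure: `ν({0}) = 0` and `∫ (|u|² ∧ 1) ν(du) < ∞`. -/
structure IsLevyMeasure {m : ℕ} (ν : Measure (EuclideanSpace ℝ (Fin m))) : Prop where
  zero : ν {0} = 0
  lintegral_lt_top : ∫⁻ u, ENNReal.ofReal (min (‖u‖ ^ 2) 1) ∂ν < ⊤

/-- The Lévy–Khintchine exponent of drift `b`, Gaussian matrix `A` (covariance `Q = A Aᵀ`) and
Lévy measure `ν`, with the truncation `|u| ≤ δ`: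
`Ψ(z) = -½⟨z, Qz⟩ + i⟨z, b⟩ + ∫ (e^{i⟨z,u⟩} - 1 - i⟨z,u⟩ 1_{|u| ≤ δ}) ν(du)`. -/
noncomputable def levyExponent {m k : ℕ} (δ : ℝ) (b : EuclideanSpace ℝ (Fin m))
    (A : Matrix (Fin m) (Fin k) ℝ) (ν : Measure (EuclideanSpace ℝ (Fin m)))
    (z : EuclideanSpace ℝ (Fin m)) : ℂ :=
  -(1 / 2 : ℂ) * ((z.ofLp ⬝ᵥ (A * A.transpose).mulVec z.ofLp : ℝ) : ℂ)
    + Complex.I * ((inner ℝ z b : ℝ) : ℂ)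
    + ∫ u, (Complex.exp (Complex.I * ((inner ℝ z u : ℝ) : ℂ)) - 1
        - Complex.I * (({u | ‖u‖ ≤ δ}.indicator (fun u => inner ℝ z u) u : ℝ) : ℂ)) ∂ν

/-- `X` is a Lévy process on `[0, ∞)` whose Lévy–Itô decomposition is
`X_t = b t + A W_t + ∫₀ᵗ ∫_{|u| ≤ δ} u Ñ(ds, du)` with jump intensity `ν`, that is: a Lévy process
with characteristic triplet `(b, A Aᵀ, ν)`, where `ν` has no mass on `{|u| > δ}`. -/
structure IsSmallJumpLevyProcess {Ω : Type*} [MeasurableSpace Ω] {m k : ℕ} (δ : ℝ)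
    (b : EuclideanSpace ℝ (Fin m)) (A : Matrix (Fin m) (Fin k) ℝ)
    (ν : Measure (EuclideanSpace ℝ (Fin m)))
    (X : ℝ≥0 → Ω → EuclideanSpace ℝ (Fin m)) (P : Measure Ω) : Prop where
  isLevyProcess : IsLevyProcess X P
  isLevyMeasure : IsLevyMeasure ν
  small_jumps : ν {u | δ < ‖u‖} = 0
  charFun_eq : ∀ (t : ℝ≥0) (z : EuclideanSpace ℝ (Fin m)),
    charFun (P.map (X t)) z = Complex.exp (((t : ℝ) : ℂ) * levyExponent δ b A ν z)

/-! ### Integrals of a deterministic function against a path or a process -/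

/-- A tagged partition `a = t₀ ≤ t₁ ≤ … ≤ tₙ = b` with tags `ξᵢ ∈ [tᵢ, tᵢ₊₁]`. -/
structure TaggedPartition (a b : ℝ) where
  n : ℕ
  pts : ℕ → ℝ
  tags : ℕ → ℝ
  mono : Monotone pts
  pts_zero : pts 0 = a
  pts_last : pts n = b
  tags_mem : ∀ i < n, tags i ∈ Icc (pts i) (pts (i + 1))

/-- All the subintervals have length at most `η`. -/
def TaggedPartition.MeshLE {a b : ℝ} (π : TaggedPartition a b) (η : ℝ) : Prop :=
  ∀ i < π.n, π.pts (i + 1) - π.pts i ≤ η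

/-- The sum `∑ f(ξᵢ) (g(tᵢ₊₁) - g(tᵢ))`. -/
noncomputable def TaggedPartition.sum {a b : ℝ} (π : TaggedPartition a b) {m : ℕ} (f : ℝ → ℝ)
    (g : ℝ → EuclideanSpace ℝ (Fin m)) : EuclideanSpace ℝ (Fin m) :=
  ∑ i ∈ Finset.range π.n, f (π.tags i) • (g (π.pts (i + 1)) - g (π.pts i))

/-- `I = ∫ₐᵇ f dg`, for `a ≤ b`, as the limit of the sums as the mesh tends to zero. -/
def HasStieltjesIntegral {m : ℕ} (f : ℝ → ℝ) (g : ℝ → EuclideanSpace ℝ (Fin m)) (a b : ℝ)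
    (I : EuclideanSpace ℝ (Fin m)) : Prop :=
  ∀ ε > 0, ∃ η > 0, ∀ π : TaggedPartition a b, π.MeshLE η → ‖π.sum f g - I‖ < ε

/-- `I = ∫_{-∞}^t f dg`, the limit of `∫ₐᵗ f dg` as `a → -∞`. -/
def HasIntegralFromBot {m : ℕ} (f : ℝ → ℝ) (g : ℝ → EuclideanSpace ℝ (Fin m)) (t : ℝ)
    (I : EuclideanSpace ℝ (Fin m)) : Prop :=
  ∃ J : ℝ → EuclideanSpace ℝ (Fin m),
    (∀ a ≤ t, HasStieltjesIntegral f g a t (J a)) ∧ Tendsto J atBot (𝓝 I)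

open Classical in
/-- The value of `∫_{-∞}^t f dg` (zero if the integral does not converge). -/
noncomputable def integralFromBot {m : ℕ} (f : ℝ → ℝ) (g : ℝ → EuclideanSpace ℝ (Fin m)) (t : ℝ) :
    EuclideanSpace ℝ (Fin m) :=
  if h : ∃ I, HasIntegralFromBot f g t I then h.choose else 0

/-- The stochastic integral `I = ∫ₐᵇ f dX`, for `a ≤ b`, of a deterministic continuous `f`: the
sums converge to `I` in probability along every sequence of partitions whose mesh tends to zero. -/
def IsStochasticIntegral {Ω : Type*} [MeasurableSpace Ω] {m : ℕ} (P : Measure Ω) (f : ℝ → ℝ)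
    (X : ℝ → Ω → EuclideanSpace ℝ (Fin m)) (a b : ℝ) (I : Ω → EuclideanSpace ℝ (Fin m)) : Prop :=
  ∀ π : ℕ → TaggedPartition a b, (∀ η > 0, ∀ᶠ n in atTop, (π n).MeshLE η) →
    TendstoInMeasure P (fun n w => (π n).sum f (fun s => X s w)) atTop I

/-- The stochastic integral `I = ∫_{-∞}^t f dX`: the limit in probability of the stochastic
integrals `∫ₐᵗ f dX` as `a → -∞`. -/
def IsStochasticIntegralFromBot {Ω : Type*} [MeasurableSpace Ω] {m : ℕ} (P : Measure Ω)
    (f : ℝ → ℝ) (X : ℝ → Ω → EuclideanSpace ℝ (Fin m)) (t : ℝ)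
    (I : Ω → EuclideanSpace ℝ (Fin m)) : Prop :=
  ∃ J : ℝ → Ω → EuclideanSpace ℝ (Fin m),
    (∀ a ≤ t, IsStochasticIntegral P f X a t (J a)) ∧ TendstoInMeasure P J atBot I

/-- `Z_t(w) = e^{-μt} ∫_{-∞}^t e^{μs} dw(s)`. -/
noncomputable def ouProcess {m : ℕ} (μ t : ℝ) (w : ℝ → EuclideanSpace ℝ (Fin m)) :
    EuclideanSpace ℝ (Fin m) :=
  Real.exp (-μ * t) • integralFromBot (fun s => Real.exp (μ * s)) w t

/-! ### The integrals are well defined -/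

theorem exists_taggedPartition_meshLE {a b : ℝ} (hab : a ≤ b) {η : ℝ} (hη : 0 < η) :
    ∃ π : TaggedPartition a b, π.MeshLE η := by
  obtain ⟨n, hn⟩ := exists_nat_gt ((b - a) / η)
  have hn0 : (0 : ℝ) < n := lt_of_le_of_lt (div_nonneg (by linarith) hη.le) hn
  have hmono : Monotone (fun i : ℕ => a + (b - a) / n * i) := by
    intro i j hij
    have : (i : ℝ) ≤ j := by exact_mod_cast hij
    have h2 : 0 ≤ (b - a) / n := div_nonneg (by linarith) hn0.le
    have := mul_le_mul_of_nonneg_left this h2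
    simp only
    linarith
  refine ⟨⟨n, fun i => a + (b - a) / n * i, fun i => a + (b - a) / n * i, hmono, by simp,
    by field_simp; ring, fun i _ => ⟨le_rfl, hmono (Nat.le_succ i)⟩⟩, ?_⟩
  intro i _
  have h : (b - a) / n ≤ η := by
    rw [div_lt_iff₀ hη] at hn
    rw [div_le_iff₀ hn0]
    linarith
  push_cast
  linarith

theorem HasStieltjesIntegral.unique {m : ℕ} {f : ℝ → ℝ} {g : ℝ → EuclideanSpace ℝ (Fin m)}
    {a b : ℝ} (hab : a ≤ b) {I I' : EuclideanSpace ℝ (Fin m)}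
    (h : HasStieltjesIntegral f g a b I) (h' : HasStieltjesIntegral f g a b I') : I = I' := by
  by_contra hne
  have hpos : 0 < ‖I - I'‖ / 2 := half_pos (norm_pos_iff.2 (sub_ne_zero.2 hne))
  obtain ⟨η, hη, H⟩ := h _ hpos
  obtain ⟨η', hη', H'⟩ := h' _ hpos
  obtain ⟨π, hπ⟩ := exists_taggedPartition_meshLE hab (lt_min hη hη')
  have h1 := H π (fun i hi => (hπ i hi).trans (min_le_left _ _))
  have h2 := H' π (fun i hi => (hπ i hi).trans (min_le_right _ _))
  have h3 : ‖I - I'‖ ≤ ‖π.sum f g - I'‖ + ‖π.sum f g - I‖ := by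
    have : I - I' = (π.sum f g - I') - (π.sum f g - I) := by abel
    rw [this]
    exact norm_sub_le _ _
  linarith

theorem HasIntegralFromBot.unique {m : ℕ} {f : ℝ → ℝ} {g : ℝ → EuclideanSpace ℝ (Fin m)}
    {t : ℝ} {I I' : EuclideanSpace ℝ (Fin m)}
    (h : HasIntegralFromBot f g t I) (h' : HasIntegralFromBot f g t I') : I = I' := by
  obtain ⟨J, hJ, hl⟩ := h
  obtain ⟨J', hJ', hl'⟩ := h'
  refine tendsto_nhds_unique (hl.congr' ?_) hl'
  filter_upwards [eventually_le_atBot t] with a ha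
  exact (hJ a ha).unique ha (hJ' a ha)

theorem HasIntegralFromBot.integralFromBot_eq {m : ℕ} {f : ℝ → ℝ}
    {g : ℝ → EuclideanSpace ℝ (Fin m)} {t : ℝ} {I : EuclideanSpace ℝ (Fin m)}
    (h : HasIntegralFromBot f g t I) : integralFromBot f g t = I := by
  have hex : ∃ I, HasIntegralFromBot f g t I := ⟨I, h⟩
  rw [integralFromBot, dif_pos hex]
  exact hex.choose_spec.unique h

/-! The proof separates a pathwise part from one probabilistic fact. Paths have one-sided limits
everywhere, so they are bounded on compacts and have only countably many discontinuities. For such a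
path `w` and a C¹ weight `f`, Abel summation and dominated convergence give integration by parts,
∫ₐᵇ f dw = f(b)w(b) - f(a)w(a) - ∫ₐᵇ f' w ds (`IsRegulated.hasStieltjesIntegral`). If moreover
‖w(s)‖ ≤ C e^{-εs} near -∞ with ε < μ, one may let a → -∞, and Z_t = w(t) - e^{-μt} ∫_{-∞}^t μ
e^{μs} w(s) ds (`ouProcess_eq`). The shift identity is then a change of variables, and the equation
is the fundamental theorem of calculus.

It remains to show that almost every path grows this slowly at -∞, a statement about the Lévy
process t ↦ L_{-t}. Its exponent is O(‖z‖) at 0, hence P(‖X_t‖ > R) ≤ K/R for t ≤ 1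
(`exists_tail_le`). Ottaviani's inequality extends this to the supremum of the increments over a
unit time interval, first on dyadic grids and then by right continuity. With R = e^{εn} on the n-th
interval the bounds are summable, so Borel–Cantelli bounds all late increments by 2e^{εn}, and a
geometric sum bounds the path (`ae_exists_norm_le_exp`). Convergence in probability follows from
almost sure convergence. -/

/-! ### Regulated functions -/

/-- A function on the line all of whose one-sided limits exist. -/
def IsRegulated {E : Type*} [TopologicalSpace E] (w : ℝ → E) : Prop :=
  ∀ t, (∃ l, Tendsto w (𝓝[>] t) (𝓝 l)) ∧ ∃ l, Tendsto w (𝓝[<] t) (𝓝 l)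

theorem IsTwoSidedPath.isRegulated {m : ℕ} {w : ℝ → EuclideanSpace ℝ (Fin m)}
    (hw : IsTwoSidedPath w) : IsRegulated w := by
  obtain ⟨h1, h2, h3, h4⟩ := hw
  intro t
  constructor
  · rcases lt_or_ge t 0 with ht | ht
    · exact h4 t ht
    · exact ⟨w t, (h1 t ht).mono_left (nhdsWithin_mono _ Ioi_subset_Ici_self)⟩
  · rcases lt_or_ge 0 t with ht | ht
    · exact h2 t ht
    · exact ⟨w t, (h3 t ht).mono_left (nhdsWithin_mono _ Iio_subset_Iic_self)⟩

namespace IsRegulated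

section Metric

variable {E : Type*} [PseudoMetricSpace E] {w : ℝ → E}

/-- Let `S n` be the points of oscillation at least 1/(n+1). The right limit at t makes the
oscillation small on some (t, u), so t is isolated from the right in `S n`; such points are
countably many. -/
theorem countable_not_continuousAt (hw : IsRegulated w) : {t | ¬ ContinuousAt w t}.Countable := by
  let S : ℕ → Set ℝ := fun n =>
    {t | ¬ ∃ U ∈ 𝓝 t, ∀ x ∈ U, ∀ y ∈ U, dist (w x) (w y) < 1 / ((n : ℝ) + 1)}
  have hsub : {t | ¬ ContinuousAt w t} ⊆ ⋃ n, S n := by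
    intro t ht
    by_contra hcon
    apply ht
    rw [Metric.continuousAt_iff']
    intro ε hε
    obtain ⟨n, hn⟩ := exists_nat_one_div_lt hε
    have hn' : t ∉ S n := fun h => hcon (mem_iUnion.2 ⟨n, h⟩)
    obtain ⟨U, hU, h⟩ := not_not.1 hn'
    filter_upwards [hU] with x hx
    exact (h x hx t (mem_of_mem_nhds hU)).trans hn
  refine (countable_iUnion fun n => ?_).mono hsub
  refine (countable_setOfPred_isolated_right_within (s := S n)).mono ?_
  intro t ht
  refine ⟨ht, ?_⟩
  obtain ⟨l, hl⟩ := (hw t).1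
  have hpos : (0 : ℝ) < 1 / ((n : ℝ) + 1) / 2 := by positivity
  have hev : w ⁻¹' Metric.ball l (1 / ((n : ℝ) + 1) / 2) ∈ 𝓝[>] t :=
    hl (Metric.ball_mem_nhds _ hpos)
  obtain ⟨u, hu, hsub'⟩ := mem_nhdsGT_iff_exists_Ioo_subset.1 hev
  rw [← empty_mem_iff_bot, mem_nhdsWithin]
  refine ⟨Iio u, isOpen_Iio, hu, ?_⟩
  rintro x ⟨hxu, hxS, hxt⟩
  refine (hxS ⟨Ioo t u, Ioo_mem_nhds hxt hxu, fun y hy z hz => ?_⟩).elim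
  have h1 := hsub' hy
  have h2 := hsub' hz
  simp only [mem_preimage, Metric.mem_ball] at h1 h2
  calc dist (w y) (w z) ≤ dist (w y) l + dist (w z) l := dist_triangle_right _ _ _
    _ < _ := by linarith

theorem ae_continuousAt (hw : IsRegulated w) : ∀ᵐ t ∂(volume : Measure ℝ), ContinuousAt w t :=
  hw.countable_not_continuousAt.measure_zero _

end Metric

section Normed

variable {E : Type*} [NormedAddCommGroup E] {w : ℝ → E}

theorem aestronglyMeasurable (hw : IsRegulated w) :
    AEStronglyMeasurable w (volume : Measure ℝ) := by
  refine aestronglyMeasurable_of_tendsto_ae atTop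
    -- Sampling on the grid of width 1/(n+1) factors through ℤ, hence is measurable, and converges
    -- wherever `w` is continuous.
    (f := fun (n : ℕ) t => w ((⌊((n : ℝ) + 1) * t⌋ : ℝ) / ((n : ℝ) + 1))) (fun n => ?_) ?_
  · have h : StronglyMeasurable (fun k : ℤ => w ((k : ℝ) / ((n : ℝ) + 1))) :=
      .of_discrete
    exact (h.comp_measurable
      (Int.measurable_floor.comp (measurable_const_mul ((n : ℝ) + 1)))).aestronglyMeasurable
  · filter_upwards [hw.ae_continuousAt] with t ht
    refine ht.tendsto.comp ?_
    rw [tendsto_iff_dist_tendsto_zero]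
    refine squeeze_zero (fun _ => dist_nonneg) (fun n => ?_) tendsto_one_div_add_atTop_nhds_zero_nat
    have hn : (0 : ℝ) < (n : ℝ) + 1 := by positivity
    have h1 := Int.floor_le (((n : ℝ) + 1) * t)
    have h2 := (Int.lt_floor_add_one (((n : ℝ) + 1) * t)).le
    rw [Real.dist_eq, abs_le]
    constructor
    · rw [neg_le_sub_iff_le_add, ← add_div, le_div_iff₀ hn]
      linarith
    · rw [sub_le_iff_le_add, div_le_iff₀ hn, add_mul (1 / _), one_div, inv_mul_cancel₀ hn.ne']
      linarith

theorem exists_norm_le_Icc (hw : IsRegulated w) (a b : ℝ) : ∃ M, ∀ t ∈ Icc a b, ‖w t‖ ≤ M := by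
  refine isCompact_Icc.induction_on (p := fun s => ∃ M, ∀ t ∈ s, ‖w t‖ ≤ M) ⟨0, by simp⟩
    (fun s t hst ⟨M, hM⟩ => ⟨M, fun x hx => hM x (hst hx)⟩) ?_ ?_
  · rintro s t ⟨M, hM⟩ ⟨N, hN⟩
    refine ⟨max M N, ?_⟩
    rintro x (hx | hx)
    · exact (hM x hx).trans (le_max_left _ _)
    · exact (hN x hx).trans (le_max_right _ _)
  · intro t _
    obtain ⟨⟨l, hl⟩, l', hl'⟩ := hw t
    have h1 : ∀ᶠ x in 𝓝[>] t, ‖w x‖ ≤ ‖l‖ + 1 :=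
      (hl.norm.eventually_lt_const (lt_add_one _)).mono fun _ h => h.le
    have h2 : ∀ᶠ x in 𝓝[<] t, ‖w x‖ ≤ ‖l'‖ + 1 :=
      (hl'.norm.eventually_lt_const (lt_add_one _)).mono fun _ h => h.le
    refine ⟨{x | ‖w x‖ ≤ max (max (‖l‖ + 1) (‖l'‖ + 1)) ‖w t‖}, mem_nhdsWithin_of_mem_nhds ?_,
      _, fun x hx => hx⟩
    have h3 : ∀ᶠ x in 𝓝[≠] t, ‖w x‖ ≤ max (max (‖l‖ + 1) (‖l'‖ + 1)) ‖w t‖ := by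
      rw [← Iio_union_Ioi, nhdsWithin_union, eventually_sup]
      exact ⟨h2.mono fun x hx => hx.trans ((le_max_right _ _).trans (le_max_left _ _)),
        h1.mono fun x hx => hx.trans ((le_max_left _ _).trans (le_max_left _ _))⟩
    rw [eventually_nhdsWithin_iff] at h3
    filter_upwards [h3] with x hx
    by_cases hxt : x = t
    · subst hxt; exact le_max_right _ _
    · exact hx hxt

theorem integrableOn_smul [NormedSpace ℝ E] (hw : IsRegulated w) {f : ℝ → ℝ} (hf : Continuous f)
    (a b : ℝ) : IntegrableOn (fun s => f s • w s) (Icc a b) := by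
  obtain ⟨M, hM⟩ := hw.exists_norm_le_Icc a b
  obtain ⟨K, hK⟩ := isCompact_Icc.exists_bound_of_continuousOn (s := Icc a b) hf.continuousOn
  refine Measure.integrableOn_of_bounded (M := K * M) (by simp)
    (hf.aestronglyMeasurable.smul hw.aestronglyMeasurable) ?_
  filter_upwards [ae_restrict_mem measurableSet_Icc] with s hs
  rw [norm_smul]
  exact mul_le_mul (hK s hs) (hM s hs) (norm_nonneg _) ((norm_nonneg _).trans (hK s hs))

theorem intervalIntegrable_smul [NormedSpace ℝ E] (hw : IsRegulated w) {f : ℝ → ℝ}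
    (hf : Continuous f) (a b : ℝ) : IntervalIntegrable (fun s => f s • w s) volume a b := by
  rw [intervalIntegrable_iff]
  exact (hw.integrableOn_smul hf (min a b) (max a b)).mono_set Ioc_subset_Icc_self

end Normed

theorem wienerShift {m : ℕ} {w : ℝ → EuclideanSpace ℝ (Fin m)} (hw : IsRegulated w) (s : ℝ) :
    IsRegulated (wienerShift s w) := by
  intro t
  obtain ⟨⟨l, hl⟩, l', hl'⟩ := hw (s + t)
  constructor
  · refine ⟨l - w s, (hl.comp ?_).sub_const _⟩
    refine tendsto_nhdsWithin_of_tendsto_nhds_of_eventually_within _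
      ((continuous_const_add s).tendsto t |>.mono_left nhdsWithin_le_nhds) ?_
    filter_upwards [self_mem_nhdsWithin] with x hx
    simpa using hx
  · refine ⟨l' - w s, (hl'.comp ?_).sub_const _⟩
    refine tendsto_nhdsWithin_of_tendsto_nhds_of_eventually_within _
      ((continuous_const_add s).tendsto t |>.mono_left nhdsWithin_le_nhds) ?_
    filter_upwards [self_mem_nhdsWithin] with x hx
    simpa using hx

end IsRegulated

/-! ### Riemann–Stieltjes sums against regulated functions -/

namespace TaggedPartition

variable {a b : ℝ} (π : TaggedPartition a b)

protected theorem le {a b : ℝ} (π : TaggedPartition a b) : a ≤ b :=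
  π.pts_zero.symm.trans_le ((π.mono (Nat.zero_le _)).trans_eq π.pts_last)

/-- The endpoints `a`, `b` together with the tags, in increasing order. -/
def node : ℕ → ℝ
  | 0 => a
  -- Index shift: the tag ξᵢ is node i + 1. The value b past the last tag keeps the sequence
  -- monotone on all of ℕ.
  | i + 1 => if i < π.n then π.tags i else b

theorem pts_le_node_succ {i : ℕ} (hi : i ≤ π.n) : π.pts i ≤ π.node (i + 1) := by
  rw [node]
  split_ifs with h
  · exact (π.tags_mem i h).1
  · exact (π.mono hi).trans_eq π.pts_last

theorem node_le_pts {i : ℕ} (hi : i ≤ π.n) : π.node i ≤ π.pts i := by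
  cases i with
  | zero => exact π.pts_zero.ge
  | succ i =>
    rw [node, if_pos (Nat.lt_of_succ_le hi)]
    exact (π.tags_mem i hi).2

theorem node_succ_last : π.node (π.n + 1) = b := by simp [node]

theorem node_mono : Monotone π.node := by
  refine monotone_nat_of_le_succ fun i => ?_
  rcases le_or_gt i π.n with h | h
  · exact (π.node_le_pts h).trans (π.pts_le_node_succ h)
  · obtain ⟨j, rfl⟩ : ∃ j, i = j + 1 := ⟨i - 1, by omega⟩
    rw [node, node, if_neg (by omega), if_neg (by omega)]

/-- Nodes and partition points interlace, so s lies between the neighbours of tᵢ. At i = 0 and i = n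
the missing neighbour is replaced by the endpoint tᵢ itself. -/
theorem abs_pts_sub_le {η : ℝ} (hη0 : 0 ≤ η) (hη : π.MeshLE η) {i : ℕ} (hi : i ≤ π.n) {s : ℝ}
    (hs : s ∈ Ioc (π.node i) (π.node (i + 1))) : |π.pts i - s| ≤ η := by
  rw [abs_le]
  constructor
  · rcases hi.lt_or_eq with h | h
    · have h1 := π.node_le_pts (i := i + 1) h
      have h2 := hη i h
      linarith [hs.2]
    · subst h
      have h1 := hs.2.trans_eq (π.node_succ_last.trans π.pts_last.symm)
      linarith
  · cases i with
    | zero =>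
      have h1 := π.pts_zero.trans_lt hs.1
      linarith
    | succ i =>
      have h1 := π.pts_le_node_succ (i := i) (by omega)
      have h2 := hη i (by omega)
      linarith [hs.1]

variable {m : ℕ}

/-- The step function with value `g (tᵢ)` between the tags `ξᵢ₋₁` and `ξᵢ`. -/
noncomputable def step (g : ℝ → EuclideanSpace ℝ (Fin m)) (s : ℝ) : EuclideanSpace ℝ (Fin m) :=
  ∑ i ∈ Finset.range (π.n + 1),
    (Ioc (π.node i) (π.node (i + 1))).indicator (fun _ => g (π.pts i)) s

theorem step_eq (g : ℝ → EuclideanSpace ℝ (Fin m)) {i : ℕ} (hi : i ≤ π.n) {s : ℝ}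
    (hs : s ∈ Ioc (π.node i) (π.node (i + 1))) : π.step g s = g (π.pts i) := by
  rw [step, Finset.sum_eq_single i, indicator_of_mem hs]
  · intro j _ hji
    refine indicator_of_notMem (fun hj => ?_) _
    exact disjoint_left.1 (π.node_mono.pairwise_disjoint_on_Ioc_succ hji) hj hs
  · intro h
    exact (h (Finset.mem_range.2 (by omega))).elim

theorem exists_mem_Ioc_node {s : ℝ} (hs : s ∈ Ioc a b) :
    ∃ i ≤ π.n, s ∈ Ioc (π.node i) (π.node (i + 1)) := by
  have h := π.node_mono.biUnion_Ico_Ioc_map_succ 0 (π.n + 1)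
  rw [π.node_succ_last, show π.node 0 = a from rfl] at h
  rw [← h] at hs
  simp only [mem_iUnion, mem_Ico] at hs
  obtain ⟨i, hi, hs⟩ := hs
  exact ⟨i, by omega, hs⟩

theorem stronglyMeasurable_step (g : ℝ → EuclideanSpace ℝ (Fin m)) :
    StronglyMeasurable (π.step g) := by
  unfold step
  exact Finset.stronglyMeasurable_fun_sum _ fun i _ =>
    stronglyMeasurable_const.indicator measurableSet_Ioc

theorem pts_mem {i : ℕ} (hi : i ≤ π.n) : π.pts i ∈ Icc a b := by
  have h1 := π.mono (Nat.zero_le i)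
  have h2 := π.mono hi
  rw [π.pts_zero] at h1
  rw [π.pts_last] at h2
  exact ⟨h1, h2⟩

theorem sum_smul_sub_eq {E : Type*} [AddCommGroup E] [Module ℝ E] (c : ℕ → ℝ) (v : ℕ → E)
    (n : ℕ) : ∑ i ∈ Finset.range n, c (i + 1) • (v (i + 1) - v i) =
      c (n + 1) • v n - c 0 • v 0 - ∑ i ∈ Finset.range (n + 1), (c (i + 1) - c i) • v i := by
  induction n with
  | zero => simp [sub_smul]
  | succ n ih =>
    rw [Finset.sum_range_succ, ih, Finset.sum_range_succ _ (n + 1)]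
    module

/-- Abel summation moves the differences from g to f, and each difference of f is the integral of f'
over an interval where the step function is constant. The identity is exact, before any limit. -/
theorem sum_eq_sub_integral {f f' : ℝ → ℝ} (hf : ∀ s, HasDerivAt f (f' s) s)
    (hf' : Continuous f') (g : ℝ → EuclideanSpace ℝ (Fin m)) :
    π.sum f g = f b • g b - f a • g a - ∫ s in a..b, f' s • π.step g s := by
  have hpiece : ∀ i < π.n + 1, EqOn (fun s => f' s • g (π.pts i)) (fun s => f' s • π.step g s)
      (uIoc (π.node i) (π.node (i + 1))) := by
    intro i hi s hs
    rw [uIoc_of_le (π.node_mono (Nat.le_succ i))] at hs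
    simp only [π.step_eq g (Nat.lt_succ_iff.1 hi) hs]
  have hint : ∀ i < π.n + 1, IntervalIntegrable (fun s => f' s • π.step g s) volume
      (π.node i) (π.node (i + 1)) := fun i hi =>
    (Continuous.intervalIntegrable (by fun_prop) _ _).congr (hpiece i hi)
  have h := intervalIntegral.sum_integral_adjacent_intervals hint
  rw [π.node_succ_last, show π.node 0 = a from rfl] at h
  rw [← h]
  have h2 : ∀ i ∈ Finset.range (π.n + 1),
      ∫ s in π.node i..π.node (i + 1), f' s • π.step g s =
        (f (π.node (i + 1)) - f (π.node i)) • g (π.pts i) := by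
    intro i hi
    rw [← intervalIntegral.integral_congr_ae (ae_of_all _ (hpiece i (Finset.mem_range.1 hi))),
      intervalIntegral.integral_smul_const,
      intervalIntegral.integral_eq_sub_of_hasDerivAt (fun s _ => hf s)
        (hf'.intervalIntegrable _ _)]
  rw [Finset.sum_congr rfl h2]
  have h3 := sum_smul_sub_eq (fun i => f (π.node i)) (fun i => g (π.pts i)) π.n
  simp only [π.node_succ_last, π.pts_last, π.pts_zero, show π.node 0 = a from rfl] at h3
  rw [← h3, sum]
  refine Finset.sum_congr rfl fun i hi => ?_
  rw [node, if_pos (Finset.mem_range.1 hi)]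

end TaggedPartition

/-- At a continuity point s of `w` the step function converges to w(s), because it takes the value
of `w` at a point within the mesh of s. Dominated convergence does the rest. -/
theorem IsRegulated.tendsto_sum {m : ℕ} {w : ℝ → EuclideanSpace ℝ (Fin m)} (hw : IsRegulated w)
    {f f' : ℝ → ℝ} (hf : ∀ s, HasDerivAt f (f' s) s) (hf' : Continuous f') {a b : ℝ}
    (π : ℕ → TaggedPartition a b) (hπ : ∀ η > 0, ∀ᶠ n in atTop, (π n).MeshLE η) :
    Tendsto (fun n => (π n).sum f w) atTop
      (𝓝 (f b • w b - f a • w a - ∫ s in a..b, f' s • w s)) := by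
  have hab := (π 0).le
  simp_rw [fun n => (π n).sum_eq_sub_integral hf hf' w]
  refine tendsto_const_nhds.sub ?_
  obtain ⟨M, hM⟩ := hw.exists_norm_le_Icc a b
  obtain ⟨K, hK⟩ := isCompact_Icc.exists_bound_of_continuousOn (s := Icc a b) hf'.continuousOn
  refine intervalIntegral.tendsto_integral_filter_of_dominated_convergence (fun _ => K * M)
    (.of_forall fun n => (hf'.stronglyMeasurable.smul
      ((π n).stronglyMeasurable_step w)).aestronglyMeasurable) ?_ (by simp) ?_
  · refine .of_forall fun n => ae_of_all _ fun s hs => ?_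
    rw [uIoc_of_le hab] at hs
    obtain ⟨i, hi, hs'⟩ := (π n).exists_mem_Ioc_node hs
    rw [(π n).step_eq w hi hs', norm_smul]
    have hs'' := Ioc_subset_Icc_self hs
    exact mul_le_mul (hK s hs'') (hM _ ((π n).pts_mem hi)) (norm_nonneg _)
      ((norm_nonneg _).trans (hK s hs''))
  · filter_upwards [hw.ae_continuousAt] with s hcont hs
    rw [uIoc_of_le hab] at hs
    refine Tendsto.const_smul ?_ _
    rw [Metric.tendsto_nhds]
    intro ε hε
    obtain ⟨η, hη, h⟩ := Metric.continuousAt_iff.1 hcont ε hε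
    filter_upwards [hπ (η / 2) (half_pos hη)] with n hn
    obtain ⟨i, hi, hs'⟩ := (π n).exists_mem_Ioc_node hs
    rw [(π n).step_eq w hi hs']
    apply h
    rw [Real.dist_eq]
    exact ((π n).abs_pts_sub_le (half_pos hη).le hn hi hs').trans_lt (half_lt_self hη)

theorem IsRegulated.hasStieltjesIntegral {m : ℕ} {w : ℝ → EuclideanSpace ℝ (Fin m)}
    (hw : IsRegulated w) {f f' : ℝ → ℝ} (hf : ∀ s, HasDerivAt f (f' s) s) (hf' : Continuous f')
    (a b : ℝ) :
    HasStieltjesIntegral f w a b (f b • w b - f a • w a - ∫ s in a..b, f' s • w s) := by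
  -- Failure of the ε–η statement yields bad partitions of mesh at most 1/(n+1), which contradicts
  -- the sequential limit.
  by_contra hcon
  simp only [HasStieltjesIntegral, not_forall, not_exists, not_and, not_lt] at hcon
  obtain ⟨ε, hε, H⟩ := hcon
  choose π hπ hbad using fun n : ℕ => H (1 / ((n : ℝ) + 1)) (by positivity)
  have hmesh : ∀ η > 0, ∀ᶠ n in atTop, (π n).MeshLE η := by
    intro η hη
    filter_upwards [tendsto_one_div_add_atTop_nhds_zero_nat.eventually_lt_const hη] with n hn i hi
    exact (hπ n i hi).trans hn.le
  have := (tendsto_iff_norm_sub_tendsto_zero.1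
    (hw.tendsto_sum hf hf' π hmesh)).eventually_lt_const hε
  obtain ⟨n, hn⟩ := this.exists
  exact (hbad n).not_gt hn

/-! ### The Ornstein–Uhlenbeck functional on paths of slow exponential growth at `-∞` -/

section Exp

variable {μ : ℝ}

theorem hasDerivAt_exp_const_mul (μ s : ℝ) :
    HasDerivAt (fun s => Real.exp (μ * s)) (μ * Real.exp (μ * s)) s := by
  have h := ((hasDerivAt_id s).const_mul μ).exp
  simpa [mul_comm] using h

theorem continuous_mul_exp_const_mul (μ : ℝ) : Continuous fun s => μ * Real.exp (μ * s) := by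
  fun_prop

/-- `w` is regulated, and `‖w s‖ ≤ C e^{-εs}` for all `s` close to `-∞`, for some `ε < μ`. -/
structure IsSlowlyGrowing {m : ℕ} (μ : ℝ) (w : ℝ → EuclideanSpace ℝ (Fin m)) : Prop where
  isRegulated : IsRegulated w
  growth : ∃ ε C : ℝ, 0 ≤ ε ∧ ε < μ ∧ ∀ᶠ s in atBot, ‖w s‖ ≤ C * Real.exp (-(ε * s))

namespace IsSlowlyGrowing

variable {m : ℕ} {w : ℝ → EuclideanSpace ℝ (Fin m)}

theorem pos (hw : IsSlowlyGrowing μ w) : 0 < μ := by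
  obtain ⟨ε, C, h0, h1, -⟩ := hw.growth
  exact h0.trans_lt h1

theorem wienerShift (hw : IsSlowlyGrowing μ w) (s : ℝ) :
    IsSlowlyGrowing μ (wienerShift s w) := by
  refine ⟨hw.isRegulated.wienerShift s, ?_⟩
  obtain ⟨ε, C, h0, h1, h⟩ := hw.growth
  refine ⟨ε, C * Real.exp (-(ε * s)) + ‖w s‖, h0, h1, ?_⟩
  filter_upwards [(tendsto_atBot_add_const_left atBot s tendsto_id).eventually h,
    eventually_le_atBot 0] with u hu hu0
  simp only [id] at hu
  -- For u ≤ 0 this factor absorbs the constant w(s) into the exponential bound.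
  have h3 : 1 ≤ Real.exp (-(ε * u)) :=
    Real.one_le_exp (neg_nonneg.2 (mul_nonpos_of_nonneg_of_nonpos h0 hu0))
  calc ‖w (s + u) - w s‖ ≤ ‖w (s + u)‖ + ‖w s‖ := norm_sub_le _ _
    _ ≤ C * Real.exp (-(ε * (s + u))) + ‖w s‖ * Real.exp (-(ε * u)) :=
        add_le_add hu (le_mul_of_one_le_right (norm_nonneg _) h3)
    _ = _ := by
        rw [show -(ε * (s + u)) = -(ε * s) + -(ε * u) by ring, Real.exp_add]
        ring

theorem tendsto_exp_smul (hw : IsSlowlyGrowing μ w) :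
    Tendsto (fun s => Real.exp (μ * s) • w s) atBot (𝓝 0) := by
  obtain ⟨ε, C, h0, h1, h⟩ := hw.growth
  refine squeeze_zero_norm' (a := fun s => C * Real.exp ((μ - ε) * s)) ?_ ?_
  · filter_upwards [h] with s hs
    rw [norm_smul, Real.norm_eq_abs, Real.abs_exp]
    calc _ ≤ Real.exp (μ * s) * (C * Real.exp (-(ε * s))) :=
          mul_le_mul_of_nonneg_left hs (Real.exp_pos _).le
      _ = C * (Real.exp (μ * s) * Real.exp (-(ε * s))) := by ring
      _ = _ := by rw [← Real.exp_add]; ring_nf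
  · rw [← mul_zero C]
    exact (Real.tendsto_exp_atBot.comp
      (tendsto_id.const_mul_atBot (sub_pos.2 h1))).const_mul C

theorem integrableOn_Iic (hw : IsSlowlyGrowing μ w) (t : ℝ) :
    IntegrableOn (fun s => (μ * Real.exp (μ * s)) • w s) (Iic t) := by
  obtain ⟨ε, C, h0, h1, h⟩ := hw.growth
  obtain ⟨T, hT⟩ := eventually_atBot.1 h
  have hsub : Iic t ⊆ Iic T ∪ Icc T t := fun s hs =>
    (le_total s T).imp id fun h => ⟨h, hs⟩
  refine IntegrableOn.mono_set (IntegrableOn.union ?_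
    (hw.isRegulated.integrableOn_smul (continuous_mul_exp_const_mul μ) T t)) hsub
  refine Integrable.mono' ((integrableOn_exp_mul_Iic (sub_pos.2 h1) T).const_mul (μ * C))
    ((continuous_mul_exp_const_mul μ).aestronglyMeasurable.smul
      hw.isRegulated.aestronglyMeasurable.restrict) ?_
  filter_upwards [ae_restrict_mem measurableSet_Iic] with s hs
  have hμ := hw.pos
  rw [norm_smul, Real.norm_eq_abs, abs_of_pos (by positivity)]
  calc _ ≤ μ * Real.exp (μ * s) * (C * Real.exp (-(ε * s))) :=
        mul_le_mul_of_nonneg_left (hT s hs) (by positivity)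
    _ = μ * C * (Real.exp (μ * s) * Real.exp (-(ε * s))) := by ring
    _ = _ := by rw [← Real.exp_add]; ring_nf

theorem tendsto_integral (hw : IsSlowlyGrowing μ w) (t : ℝ) :
    Tendsto (fun a => Real.exp (μ * t) • w t - Real.exp (μ * a) • w a
        - ∫ s in a..t, (μ * Real.exp (μ * s)) • w s) atBot
      (𝓝 (Real.exp (μ * t) • w t - ∫ s in Iic t, (μ * Real.exp (μ * s)) • w s)) := by
  have h := (tendsto_const_nhds (x := Real.exp (μ * t) • w t)).sub hw.tendsto_exp_smul
  rw [sub_zero] at h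
  exact h.sub (intervalIntegral_tendsto_integral_Iic t (hw.integrableOn_Iic t) tendsto_id)

theorem hasIntegralFromBot (hw : IsSlowlyGrowing μ w) (t : ℝ) :
    HasIntegralFromBot (fun s => Real.exp (μ * s)) w t
      (Real.exp (μ * t) • w t - ∫ s in Iic t, (μ * Real.exp (μ * s)) • w s) :=
  ⟨_, fun a _ => hw.isRegulated.hasStieltjesIntegral (hasDerivAt_exp_const_mul μ)
    (continuous_mul_exp_const_mul μ) a t, hw.tendsto_integral t⟩

theorem integralFromBot_eq (hw : IsSlowlyGrowing μ w) (t : ℝ) :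
    integralFromBot (fun s => Real.exp (μ * s)) w t =
      Real.exp (μ * t) • w t - ∫ s in Iic t, (μ * Real.exp (μ * s)) • w s :=
  (hw.hasIntegralFromBot t).integralFromBot_eq

theorem hasIntegralFromBot_integralFromBot (hw : IsSlowlyGrowing μ w) (t : ℝ) :
    HasIntegralFromBot (fun s => Real.exp (μ * s)) w t
      (integralFromBot (fun s => Real.exp (μ * s)) w t) := by
  rw [hw.integralFromBot_eq]
  exact hw.hasIntegralFromBot t

theorem ouProcess_eq (hw : IsSlowlyGrowing μ w) (t : ℝ) :
    ouProcess μ t w =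
      w t - Real.exp (-μ * t) • ∫ s in Iic t, (μ * Real.exp (μ * s)) • w s := by
  rw [ouProcess, hw.integralFromBot_eq, smul_sub, smul_smul, ← Real.exp_add, neg_mul,
    neg_add_cancel, Real.exp_zero, one_smul]

/-- Substituting r = s + u produces the factor e^{-μs}. The constant w(s) subtracted by the shift
has total weight ∫_{-∞}^t μ e^{μu} du = e^{μt}, so it cancels. -/
theorem ouProcess_add (hw : IsSlowlyGrowing μ w) (s t : ℝ) :
    ouProcess μ (s + t) w = ouProcess μ t (_root_.wienerShift s w) := by
  have hμ := hw.pos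
  rw [hw.ouProcess_eq, (hw.wienerShift s).ouProcess_eq]
  have h1 : ∫ u in Iic t, (μ * Real.exp (μ * u)) • w (s + u) =
      Real.exp (-μ * s) • ∫ r in Iic (s + t), (μ * Real.exp (μ * r)) • w r := by
    rw [← integral_smul,
      ← (measurePreserving_add_left (volume : Measure ℝ) s).setIntegral_preimage_emb
      (measurableEmbedding_addLeft s) _ (Iic (s + t))]
    have : (fun x => s + x) ⁻¹' Iic (s + t) = Iic t := by
      ext x
      simp
    rw [this]
    refine integral_congr_ae (ae_of_all _ fun u => ?_)
    simp only [smul_smul]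
    congr 1
    rw [mul_left_comm, ← Real.exp_add]
    ring_nf
  have h2 : ∫ u in Iic t, μ * Real.exp (μ * u) = Real.exp (μ * t) := by
    rw [integral_const_mul, integral_exp_mul_Iic hμ]
    field_simp
  have hI : IntegrableOn (fun u => (μ * Real.exp (μ * u)) • w s) (Iic t) :=
    ((integrableOn_exp_mul_Iic hμ t).const_mul μ).smul_const (w s)
  have h3 : IntegrableOn (fun u => (μ * Real.exp (μ * u)) • w (s + u)) (Iic t) := by
    have h := ((hw.wienerShift s).integrableOn_Iic t).add hI
    refine h.congr (ae_of_all _ fun u => ?_)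
    simp [_root_.wienerShift, smul_sub]
  have h4 : ∫ u in Iic t, (μ * Real.exp (μ * u)) • _root_.wienerShift s w u =
      Real.exp (-μ * s) • (∫ r in Iic (s + t), (μ * Real.exp (μ * r)) • w r)
        - Real.exp (μ * t) • w s := by
    simp only [_root_.wienerShift, smul_sub]
    rw [integral_sub h3 hI, h1, integral_smul_const, h2]
  rw [h4, smul_sub, smul_smul, smul_smul, ← Real.exp_add, ← Real.exp_add, _root_.wienerShift]
  rw [show -μ * t + μ * t = 0 by ring, show -μ * t + -μ * s = -μ * (s + t) by ring,
    Real.exp_zero, one_smul]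
  abel

/-! ### The Ornstein–Uhlenbeck equation along a path -/

theorem integral_Iic_eq (hw : IsSlowlyGrowing μ w) :
    (fun t => ∫ s in Iic t, (μ * Real.exp (μ * s)) • w s) = fun t =>
      (∫ s in (0 : ℝ)..t, (μ * Real.exp (μ * s)) • w s) +
        ∫ s in Iic (0 : ℝ), (μ * Real.exp (μ * s)) • w s := by
  ext1 t
  rw [← intervalIntegral.integral_Iic_sub_Iic (hw.integrableOn_Iic 0) (hw.integrableOn_Iic t),
    sub_add_cancel]

theorem continuous_integral_Iic (hw : IsSlowlyGrowing μ w) :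
    Continuous fun t => ∫ s in Iic t, (μ * Real.exp (μ * s)) • w s := by
  rw [hw.integral_Iic_eq]
  exact (intervalIntegral.continuous_primitive
    (hw.isRegulated.intervalIntegrable_smul (continuous_mul_exp_const_mul μ)) 0).add_const _

theorem hasDerivAt_integral_Iic (hw : IsSlowlyGrowing μ w) {t : ℝ} (ht : ContinuousAt w t) :
    HasDerivAt (fun t => ∫ s in Iic t, (μ * Real.exp (μ * s)) • w s)
      ((μ * Real.exp (μ * t)) • w t) t := by
  rw [hw.integral_Iic_eq]
  have hc := continuous_mul_exp_const_mul μ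
  exact (intervalIntegral.integral_hasDerivAt_right (hw.isRegulated.intervalIntegrable_smul hc 0 t)
    ⟨univ, univ_mem, (hc.aestronglyMeasurable.smul
      hw.isRegulated.aestronglyMeasurable).restrict⟩ (hc.continuousAt.smul ht)).add_const _

theorem intervalIntegrable_ouProcess (hw : IsSlowlyGrowing μ w) (s t : ℝ) :
    IntervalIntegrable (fun r => ouProcess μ r w) volume s t := by
  simp_rw [hw.ouProcess_eq]
  have h1 := hw.isRegulated.intervalIntegrable_smul (f := fun _ => 1) continuous_const s t
  simp only [one_smul] at h1
  have h2 := hw.continuous_integral_Iic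
  exact h1.sub (Continuous.intervalIntegrable (by fun_prop) s t)

/-- Z jumps with `w`, but w - Z is the continuous function e^{-μr} ∫_{-∞}^r μ e^{μu} w(u) du. Its
derivative is μ Z_r off the countable set of discontinuities of `w`, which suffices for the
fundamental theorem. -/
theorem ouProcess_sub (hw : IsSlowlyGrowing μ w) (s t : ℝ) :
    ouProcess μ t w - ouProcess μ s w =
      -μ • (∫ r in s..t, ouProcess μ r w) + (w t - w s) := by
  have hF := hw.continuous_integral_Iic
  have key : ∫ r in s..t, μ • ouProcess μ r w =
      Real.exp (-μ * t) • (∫ u in Iic t, (μ * Real.exp (μ * u)) • w u) -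
        Real.exp (-μ * s) • ∫ u in Iic s, (μ * Real.exp (μ * u)) • w u := by
    refine integral_eq_of_hasDerivAt_off_countable
      (fun r => Real.exp (-μ * r) • ∫ u in Iic r, (μ * Real.exp (μ * u)) • w u) _
      hw.isRegulated.countable_not_continuousAt
      (by fun_prop) (fun x hx => ?_) ((hw.intervalIntegrable_ouProcess s t).smul μ)
    have h := (hasDerivAt_exp_const_mul (-μ) x).smul
      (hw.hasDerivAt_integral_Iic (not_not.1 hx.2))
    refine h.congr_deriv ?_
    rw [hw.ouProcess_eq, smul_smul,
      show Real.exp (-μ * x) * (μ * Real.exp (μ * x)) = μ by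
        rw [mul_left_comm, ← Real.exp_add]; simp]
    module
  rw [intervalIntegral.integral_smul] at key
  rw [neg_smul, key, hw.ouProcess_eq, hw.ouProcess_eq]
  abel

end IsSlowlyGrowing

end Exp

/-! ### Tails of Lévy processes with small jumps -/

theorem norm_exp_I_mul_sub_one_sub_le (x : ℝ) :
    ‖Complex.exp (Complex.I * x) - 1 - Complex.I * x‖ ≤ 2 * x ^ 2 := by
  have hn : ‖Complex.I * (x : ℂ)‖ = |x| := by simp
  rcases le_or_gt |x| 1 with h | h
  · have := Complex.norm_exp_sub_one_sub_id_le (hn.trans_le h)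
    rw [hn, sq_abs] at this
    nlinarith [sq_nonneg x]
  · have h1 : ‖Complex.exp (Complex.I * x) - 1‖ ≤ |x| := Real.norm_exp_I_mul_ofReal_sub_one_le
    have h2 := norm_sub_le (Complex.exp (Complex.I * x) - 1) (Complex.I * x)
    rw [hn] at h2
    rw [← sq_abs x]
    nlinarith

theorem exists_abs_dotProduct_mulVec_le {m : ℕ} (Q : Matrix (Fin m) (Fin m) ℝ) :
    ∃ C, 0 ≤ C ∧ ∀ z : EuclideanSpace ℝ (Fin m),
      |z.ofLp ⬝ᵥ Q.mulVec z.ofLp| ≤ C * ‖z‖ ^ 2 := by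
  refine ⟨∑ i, ∑ j, |Q i j|, by positivity, fun z => ?_⟩
  simp only [dotProduct, Matrix.mulVec, Finset.mul_sum, Finset.sum_mul]
  refine (Finset.abs_sum_le_sum_abs _ _).trans (Finset.sum_le_sum fun i _ => ?_)
  refine (Finset.abs_sum_le_sum_abs _ _).trans (Finset.sum_le_sum fun j _ => ?_)
  have hi : |z.ofLp i| ≤ ‖z‖ := PiLp.norm_apply_le z i
  have hj : |z.ofLp j| ≤ ‖z‖ := PiLp.norm_apply_le z j
  rw [abs_mul, abs_mul]
  calc |z.ofLp i| * (|Q i j| * |z.ofLp j|) ≤ ‖z‖ * (|Q i j| * ‖z‖) := by gcongr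
    _ = _ := by ring

/-- The drift term is linear in z; the Gaussian and jump terms are quadratic, hence at most linear
on the unit ball. Since ν lives on ‖u‖ ≤ δ < 1, the compensator is always present and min(‖u‖², 1) =
‖u‖². -/
theorem exists_norm_levyExponent_le {m k : ℕ} {δ : ℝ} (hδ1 : δ < 1)
    (b : EuclideanSpace ℝ (Fin m)) (A : Matrix (Fin m) (Fin k) ℝ)
    {ν : Measure (EuclideanSpace ℝ (Fin m))} (hν : IsLevyMeasure ν)
    (hδ : ν {u | δ < ‖u‖} = 0) :
    ∃ C, 0 ≤ C ∧ ∀ z : EuclideanSpace ℝ (Fin m), ‖z‖ ≤ 1 →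
      ‖levyExponent δ b A ν z‖ ≤ C * ‖z‖ := by
  obtain ⟨C, hC, hQ⟩ := exists_abs_dotProduct_mulVec_le (A * A.transpose)
  have hint : Integrable (fun u : EuclideanSpace ℝ (Fin m) => min (‖u‖ ^ 2) 1) ν := by
    refine ⟨by fun_prop, ?_⟩
    rw [hasFiniteIntegral_iff_ofReal (ae_of_all _ fun u => by positivity)]
    exact hν.lintegral_lt_top
  have hae : ∀ᵐ u ∂ν, ‖u‖ ≤ δ := by
    rw [ae_iff]
    simpa using hδ
  set M := ∫ u, min (‖u‖ ^ 2) 1 ∂ν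
  have hM : 0 ≤ M := integral_nonneg fun u => by positivity
  refine ⟨C + ‖b‖ + 2 * M, by positivity, fun z hz => ?_⟩
  have hz2 : ‖z‖ ^ 2 ≤ ‖z‖ := by nlinarith [norm_nonneg z]
  have h1 : ‖-(1 / 2 : ℂ) * ((z.ofLp ⬝ᵥ (A * A.transpose).mulVec z.ofLp : ℝ) : ℂ)‖
      ≤ C * ‖z‖ := by
    rw [norm_mul, Complex.norm_real, Real.norm_eq_abs]
    have : ‖-(1 / 2 : ℂ)‖ ≤ 1 := by norm_num
    calc _ ≤ 1 * (C * ‖z‖ ^ 2) := mul_le_mul this (hQ z) (abs_nonneg _) zero_le_one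
      _ ≤ _ := by rw [one_mul]; gcongr
  have h2 : ‖Complex.I * ((inner ℝ z b : ℝ) : ℂ)‖ ≤ ‖b‖ * ‖z‖ := by
    rw [norm_mul, Complex.norm_I, one_mul, Complex.norm_real, mul_comm]
    exact norm_inner_le_norm z b
  have h3 : ‖∫ u, (Complex.exp (Complex.I * ((inner ℝ z u : ℝ) : ℂ)) - 1
        - Complex.I * (({u | ‖u‖ ≤ δ}.indicator (fun u => inner ℝ z u) u : ℝ) : ℂ)) ∂ν‖
      ≤ 2 * M * ‖z‖ := by
    have h := norm_integral_le_of_norm_le (hint.const_mul (2 * ‖z‖))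
      (f := fun u => (Complex.exp (Complex.I * ((inner ℝ z u : ℝ) : ℂ)) - 1
        - Complex.I * (({u | ‖u‖ ≤ δ}.indicator (fun u => inner ℝ z u) u : ℝ) : ℂ))) ?_
    · rw [integral_const_mul] at h
      linarith
    · filter_upwards [hae] with u hu
      rw [indicator_of_mem (by exact hu)]
      refine (norm_exp_I_mul_sub_one_sub_le _).trans ?_
      have hu1 : ‖u‖ ^ 2 ≤ 1 := by nlinarith [norm_nonneg u]
      rw [min_eq_left hu1]
      have h4 : (inner ℝ z u : ℝ) ^ 2 ≤ (‖z‖ * ‖u‖) ^ 2 :=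
        sq_le_sq' (neg_le_of_abs_le (abs_real_inner_le_norm z u)) (real_inner_le_norm z u)
      calc 2 * (inner ℝ z u : ℝ) ^ 2 ≤ 2 * (‖z‖ ^ 2 * ‖u‖ ^ 2) := by rw [← mul_pow]; gcongr
        _ ≤ 2 * (‖z‖ * ‖u‖ ^ 2) := by gcongr
        _ = _ := by ring
  calc ‖levyExponent δ b A ν z‖ ≤ C * ‖z‖ + ‖b‖ * ‖z‖ + 2 * M * ‖z‖ :=
        (norm_add_le _ _).trans (add_le_add ((norm_add_le _ _).trans (add_le_add h1 h2)) h3)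
    _ = _ := by ring

/-- Each coordinate tail at level ρ is controlled by averaging 1 - φ over |t| ≤ 2/ρ. The condition
on R puts this window inside the ball of radius r. -/
theorem measureReal_lt_norm_le_of_charFun {m : ℕ} {Q : Measure (EuclideanSpace ℝ (Fin m))}
    [IsProbabilityMeasure Q] {C r : ℝ} (hC : 0 ≤ C) (hr : 0 < r)
    (h : ∀ z, ‖z‖ ≤ r → ‖1 - charFun Q z‖ ≤ C * ‖z‖) {R : ℝ} (hR : 0 < R)
    (hRr : 2 * (m + 1) / r ≤ R) :
    Q.real {x | R < ‖x‖} ≤ 4 * C * m * (m + 1) / R := by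
  -- If all m coordinates are at most ρ then ‖x‖ ≤ mρ < R; dividing by m + 1 also covers m = 0.
  set ρ := R / (m + 1) with hρ
  have hm : (0 : ℝ) < m + 1 := by positivity
  have hρ0 : 0 < ρ := by positivity
  have hρr : 2 * ρ⁻¹ ≤ r := by
    rw [hρ, inv_div, ← mul_div_assoc, div_le_iff₀ hR]
    rwa [div_le_iff₀ hr, mul_comm R] at hRr
  have hsub : {x : EuclideanSpace ℝ (Fin m) | R < ‖x‖} ⊆
      ⋃ i ∈ (Finset.univ : Finset (Fin m)),
        {x | ρ < |inner ℝ (EuclideanSpace.single i (1 : ℝ)) x|} := by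
    intro x hx
    by_contra hcon
    simp only [mem_iUnion, Finset.mem_univ, exists_prop, true_and, not_exists,
      mem_ofPred_eq, not_lt, EuclideanSpace.inner_single_left, map_one, one_mul] at hcon
    have h1 : ‖x‖ ≤ ∑ i, ‖x i‖ := by
      have h2 : x = ∑ i, x i • EuclideanSpace.single i (1 : ℝ) := by
        ext j
        simp [Finset.sum_apply, Pi.single_apply]
      conv_lhs => rw [h2]
      refine (norm_sum_le _ _).trans (Finset.sum_le_sum fun i _ => ?_)
      simp [norm_smul]
    have h2 : ∑ i, ‖x i‖ ≤ m * ρ := by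
      refine (Finset.sum_le_sum fun i _ => hcon i).trans ?_
      simp
    have h3 : R = (m + 1) * ρ := by rw [hρ]; field_simp
    have hx' : R < ‖x‖ := hx
    nlinarith
  have hcoord : ∀ i : Fin m,
      Q.real {x | ρ < |inner ℝ (EuclideanSpace.single i (1 : ℝ)) x|} ≤ 4 * C / ρ := by
    intro i
    refine (measureReal_abs_inner_gt_le_integral_charFun hρ0).trans ?_
    have hb : ‖∫ t in (-2 * ρ⁻¹)..(2 * ρ⁻¹),
        1 - charFun Q (t • EuclideanSpace.single i (1 : ℝ))‖ ≤
          C * (2 * ρ⁻¹) * |2 * ρ⁻¹ - -2 * ρ⁻¹| := by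
      refine intervalIntegral.norm_integral_le_of_norm_le_const fun t ht => ?_
      have hpos : 0 < ρ⁻¹ := inv_pos.2 hρ0
      rw [uIoc_of_le (by linarith)] at ht
      have ht' : |t| ≤ 2 * ρ⁻¹ := abs_le.2 ⟨by linarith [ht.1], ht.2⟩
      have hnorm : ‖t • EuclideanSpace.single i (1 : ℝ)‖ = |t| := by simp [norm_smul]
      refine (h _ (by rw [hnorm]; exact ht'.trans hρr)).trans ?_
      rw [hnorm]
      gcongr
    have he : |2 * ρ⁻¹ - -2 * ρ⁻¹| = 4 * ρ⁻¹ := by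
      rw [abs_of_pos (by have := inv_pos.2 hρ0; linarith)]
      ring
    rw [he] at hb
    calc _ ≤ 2⁻¹ * ρ * (C * (2 * ρ⁻¹) * (4 * ρ⁻¹)) := by gcongr
      _ = _ := by field_simp
  calc Q.real {x | R < ‖x‖} ≤ _ := measureReal_mono hsub (measure_ne_top _ _)
    _ ≤ _ := measureReal_biUnion_finset_le _ _
    _ ≤ ∑ _i : Fin m, 4 * C / ρ := Finset.sum_le_sum fun i _ => hcoord i
    _ = _ := by
      simp only [Finset.sum_const, Finset.card_univ, Fintype.card_fin, nsmul_eq_mul, hρ]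
      field_simp

theorem IsSmallJumpLevyProcess.exists_tail_le {Ω : Type*} [MeasurableSpace Ω] {m k : ℕ} {δ : ℝ}
    (hδ1 : δ < 1) {b : EuclideanSpace ℝ (Fin m)} {A : Matrix (Fin m) (Fin k) ℝ}
    {ν : Measure (EuclideanSpace ℝ (Fin m))} {X : ℝ≥0 → Ω → EuclideanSpace ℝ (Fin m)}
    {P : Measure Ω} [IsProbabilityMeasure P] (hX : IsSmallJumpLevyProcess δ b A ν X P) :
    ∃ K, 0 < K ∧ ∀ t ≤ 1, ∀ R > 0, P.real {w | R < ‖X t w‖} ≤ K / R := by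
  obtain ⟨C, hC, hΨ⟩ := exists_norm_levyExponent_le hδ1 b A hX.isLevyMeasure hX.small_jumps
  -- This radius gives ‖tΨ(z)‖ ≤ 1, where |eˣ - 1| ≤ 2|x| holds.
  set r : ℝ := 1 / (C + 1) with hr
  have hr0 : 0 < r := by positivity
  have hr1 : r ≤ 1 := by rw [hr, div_le_one (by positivity)]; linarith
  have hCr : C * r ≤ 1 := by
    rw [hr, mul_one_div, div_le_one (by positivity)]
    linarith
  -- The second entry makes K/R ≥ 1 for small R, where the tail bound is trivial.
  refine ⟨max (4 * (2 * C) * m * (m + 1)) (2 * (m + 1) / r),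
    lt_max_of_lt_right (by positivity), fun t ht R hR => ?_⟩
  rcases le_or_gt (2 * (m + 1) / r) R with hRr | hRr
  · have hm := hX.isLevyProcess.aemeasurable t
    have : IsProbabilityMeasure (P.map (X t)) := Measure.isProbabilityMeasure_map hm
    have hchar : ∀ z, ‖z‖ ≤ r → ‖1 - charFun (P.map (X t)) z‖ ≤ 2 * C * ‖z‖ := by
      intro z hz
      have ht' : ‖(((t : ℝ) : ℂ)) * levyExponent δ b A ν z‖ ≤ C * ‖z‖ := by
        rw [norm_mul, Complex.norm_real, Real.norm_eq_abs, abs_of_nonneg t.coe_nonneg]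
        calc (t : ℝ) * ‖levyExponent δ b A ν z‖ ≤ 1 * (C * ‖z‖) :=
              mul_le_mul (by exact_mod_cast ht) (hΨ z (hz.trans hr1)) (norm_nonneg _) zero_le_one
          _ = _ := one_mul _
      rw [hX.charFun_eq, norm_sub_rev]
      refine (Complex.norm_exp_sub_one_le (ht'.trans ?_)).trans ?_
      · exact (mul_le_mul_of_nonneg_left hz hC).trans hCr
      · linarith
    have h := measureReal_lt_norm_le_of_charFun (by positivity) hr0 hchar hR hRr
    rw [measureReal_def, Measure.map_apply_of_aemeasurable hm
      (measurableSet_lt measurable_const measurable_norm)] at h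
    exact h.trans (div_le_div_of_nonneg_right (le_max_left _ _) hR.le)
  · refine measureReal_le_one.trans ?_
    rw [one_le_div hR]
    exact hRr.le.trans (le_max_right _ _)

/-! ### Ottaviani's maximal inequality -/

section Ottaviani

variable {Ω E : Type*} [MeasurableSpace Ω] {P : Measure Ω} [NormedAddCommGroup E]
  [MeasurableSpace E] [BorelSpace E] [SecondCountableTopology E]

theorem ProbabilityTheory.iIndepFun.measureReal_firstExit_inter {Y : ℕ → Ω → E}
    (hY : iIndepFun Y P) (hm : ∀ i, Measurable (Y i)) (N k : ℕ) (R r : ℝ) :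
    P.real ({w | r < ‖∑ i ∈ Finset.range k, Y i w‖ ∧
        ∀ j < k, ‖∑ i ∈ Finset.range j, Y i w‖ ≤ r} ∩
      {w | ‖∑ i ∈ Finset.Ico k N, Y i w‖ ≤ R}) =
    P.real {w | r < ‖∑ i ∈ Finset.range k, Y i w‖ ∧
        ∀ j < k, ‖∑ i ∈ Finset.range j, Y i w‖ ≤ r} *
      P.real {w | ‖∑ i ∈ Finset.Ico k N, Y i w‖ ≤ R} := by
  have hdisj : Disjoint (Finset.range k) (Finset.Ico k N) := by
    rw [Finset.disjoint_left]
    intro i hi hi'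
    simp at hi hi'
    omega
  have hind := hY.indepFun_finset _ _ hdisj hm
  -- Partial sums written as functions of the first k increments alone, so that the exit event is
  -- visibly independent of the later ones.
  let ps : ℕ → (Finset.range k → E) → E := fun j v => ∑ i, if i.1 < j then v i else 0
  have hps : ∀ j, Measurable (ps j) := fun j => by
    refine Finset.measurable_fun_sum _ fun i _ => ?_
    split_ifs <;> fun_prop
  have hps_eq : ∀ j ≤ k, ∀ w, ps j (fun i => Y i w) = ∑ i ∈ Finset.range j, Y i w := by
    intro j hj w
    simp only [ps]
    rw [Finset.sum_coe_sort (Finset.range k) (fun i => if i < j then Y i w else 0),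
      ← Finset.sum_filter]
    congr 1
    ext i
    simp
    omega
  let T : Set (Finset.range k → E) := {v | r < ‖ps k v‖ ∧ ∀ j < k, ‖ps j v‖ ≤ r}
  have hT : MeasurableSet T := by
    refine (measurableSet_lt measurable_const (hps k).norm).inter ?_
    have : {v | ∀ j < k, ‖ps j v‖ ≤ r} = ⋂ j, ⋂ (_ : j < k), {v | ‖ps j v‖ ≤ r} := by
      ext v
      simp
    change MeasurableSet {v | ∀ j < k, ‖ps j v‖ ≤ r}
    rw [this]
    exact .iInter fun j => .iInter fun _ => measurableSet_le (hps j).norm measurable_const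
  let U : Set (Finset.Ico k N → E) := {v | ‖∑ i, v i‖ ≤ R}
  have hU : MeasurableSet U := measurableSet_le (by fun_prop) measurable_const
  have h1 : {w | r < ‖∑ i ∈ Finset.range k, Y i w‖ ∧
      ∀ j < k, ‖∑ i ∈ Finset.range j, Y i w‖ ≤ r} =
      (fun w (i : Finset.range k) => Y i w) ⁻¹' T := by
    ext w
    simp only [T, mem_preimage, mem_ofPred_eq, hps_eq k le_rfl w]
    refine and_congr_right fun _ => forall₂_congr fun j hj => ?_
    rw [hps_eq j hj.le w]
  have h2 : {w | ‖∑ i ∈ Finset.Ico k N, Y i w‖ ≤ R} =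
      (fun w (i : Finset.Ico k N) => Y i w) ⁻¹' U := by
    ext w
    simp only [U, mem_preimage, mem_ofPred_eq]
    rw [Finset.sum_coe_sort (Finset.Ico k N) (fun i => Y i w)]
  rw [h1, h2, measureReal_def, hind.measure_inter_preimage_eq_mul _ _ hT hU, ENNReal.toReal_mul]
  rfl

/-- Split by the first k at which the partial sum exceeds 2R. Independently of this event, the
remaining sum is at most R with probability at least 1/2, and then the full sum still exceeds R. -/
theorem ProbabilityTheory.iIndepFun.ottaviani [IsProbabilityMeasure P] {Y : ℕ → Ω → E}
    (hY : iIndepFun Y P)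
    (hm : ∀ i, Measurable (Y i)) (N : ℕ) {R : ℝ}
    (hR : ∀ k ≤ N, P.real {w | R < ‖∑ i ∈ Finset.Ico k N, Y i w‖} ≤ 1 / 2) :
    P.real {w | ∃ k ≤ N, 2 * R < ‖∑ i ∈ Finset.range k, Y i w‖} ≤
      2 * P.real {w | R < ‖∑ i ∈ Finset.range N, Y i w‖} := by
  set S : ℕ → Ω → E := fun k w => ∑ i ∈ Finset.range k, Y i w with hS
  set D : ℕ → Ω → E := fun k w => ∑ i ∈ Finset.Ico k N, Y i w with hD
  have hSm : ∀ k, Measurable (S k) := fun k => by fun_prop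
  have hDm : ∀ k, Measurable (D k) := fun k => by fun_prop
  let F : ℕ → Set Ω := fun k => {w | 2 * R < ‖S k w‖ ∧ ∀ j < k, ‖S j w‖ ≤ 2 * R}
  let G : ℕ → Set Ω := fun k => {w | ‖D k w‖ ≤ R}
  have hG : ∀ k, MeasurableSet (G k) := fun k => measurableSet_le (hDm k).norm measurable_const
  have hF : ∀ k, MeasurableSet (F k) := fun k => by
    refine (measurableSet_lt measurable_const (hSm k).norm).inter ?_
    have : {w | ∀ j < k, ‖S j w‖ ≤ 2 * R} = ⋂ j, ⋂ (_ : j < k), {w | ‖S j w‖ ≤ 2 * R} := by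
      ext v
      simp
    change MeasurableSet {w | ∀ j < k, ‖S j w‖ ≤ 2 * R}
    rw [this]
    exact .iInter fun j => .iInter fun _ => measurableSet_le (hSm j).norm measurable_const
  have hdisj : Pairwise (Function.onFun Disjoint F) := by
    refine (pairwise_disjoint_on F).2 fun i j hij => disjoint_left.2 fun w hi hj => ?_
    exact (hj.2 i hij).not_gt hi.1
  have hsub : {w | ∃ k ≤ N, 2 * R < ‖S k w‖} ⊆ ⋃ k ∈ Finset.range (N + 1), F k := by
    classical
    intro w hw
    have hex : ∃ k, 2 * R < ‖S k w‖ := hw.imp fun k hk => hk.2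
    obtain ⟨k, hk, hkw⟩ := hw
    refine mem_biUnion (x := Nat.find hex)
      (Finset.mem_coe.2 (Finset.mem_range.2 (Nat.lt_succ_of_le ((Nat.find_min' hex hkw).trans hk))))
      ⟨Nat.find_spec hex, fun j hj => not_lt.1 (Nat.find_min hex hj)⟩
  have hsub2 : ⋃ k ∈ Finset.range (N + 1), F k ∩ G k ⊆ {w | R < ‖S N w‖} := by
    intro w hw
    simp only [mem_iUnion] at hw
    obtain ⟨k, hk, hF', hG'⟩ := hw
    have hk' : k ≤ N := Nat.lt_succ_iff.1 (Finset.mem_range.1 hk)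
    have h1 : S N w = S k w + D k w := (Finset.sum_range_add_sum_Ico _ hk').symm
    have h2 : ‖S k w‖ ≤ ‖S N w‖ + ‖D k w‖ := by
      rw [h1]
      simpa using norm_sub_le (S k w + D k w) (D k w)
    have h3 : 2 * R < ‖S k w‖ := hF'.1
    have h4 : ‖D k w‖ ≤ R := hG'
    change R < ‖S N w‖
    linarith
  have hhalf : ∀ k ∈ Finset.range (N + 1), P.real (F k) ≤ 2 * P.real (F k ∩ G k) := by
    intro k hk
    have hk' : k ≤ N := Nat.lt_succ_iff.1 (Finset.mem_range.1 hk)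
    have h1 : P.real (F k ∩ G k) = P.real (F k) * P.real (G k) :=
      hY.measureReal_firstExit_inter hm N k R (2 * R)
    have h2 : 1 / 2 ≤ P.real (G k) := by
      have h3 := probReal_compl_eq_one_sub (μ := P) (hG k)
      have h4 : (G k)ᶜ = {w | R < ‖D k w‖} := by
        ext w
        simp [G]
      rw [h4] at h3
      have := hR k hk'
      linarith
    rw [h1]
    nlinarith [measureReal_nonneg (μ := P) (s := F k)]
  calc P.real {w | ∃ k ≤ N, 2 * R < ‖S k w‖}
      ≤ P.real (⋃ k ∈ Finset.range (N + 1), F k) := measureReal_mono hsub (measure_ne_top _ _)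
    _ ≤ ∑ k ∈ Finset.range (N + 1), P.real (F k) := measureReal_biUnion_finset_le _ _
    _ ≤ ∑ k ∈ Finset.range (N + 1), 2 * P.real (F k ∩ G k) := Finset.sum_le_sum hhalf
    _ = 2 * P.real (⋃ k ∈ Finset.range (N + 1), F k ∩ G k) := by
        rw [measureReal_biUnion_finset
          (fun i _ j _ hij => (hdisj hij).mono inter_subset_left inter_subset_left)
          (fun k _ => (hF k).inter (hG k)), Finset.mul_sum]
    _ ≤ _ := mul_le_mul_of_nonneg_left (measureReal_mono hsub2) zero_le_two

end Ottaviani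

/-! ### Growth of Lévy processes -/

section Growth

variable {Ω : Type*} [MeasurableSpace Ω] {P : Measure Ω} {m : ℕ}
  {X : ℝ≥0 → Ω → EuclideanSpace ℝ (Fin m)}

namespace IsLevyProcess

theorem measureReal_lt_norm_sub_le (hX : IsLevyProcess X P) {K : ℝ}
    (hK : ∀ t ≤ 1, ∀ R > 0, P.real {w | R < ‖X t w‖} ≤ K / R) (s : ℝ≥0) {h : ℝ≥0} (hh : h ≤ 1)
    {R : ℝ} (hR : 0 < R) : P.real {w | R < ‖X (s + h) w - X s w‖} ≤ K / R := by
  have h1 := (hX.stationary s 0 h).measure_mem_eq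
    (measurableSet_lt (measurable_const (a := R)) measurable_norm)
  have h2 : P {w | R < ‖X (0 + h) w - X 0 w‖} = P {w | R < ‖X h w‖} := by
    refine measure_congr ?_
    filter_upwards [hX.start] with w hw
    change (R < ‖X (0 + h) w - X 0 w‖) = (R < ‖X h w‖)
    rw [hw, zero_add, sub_zero]
  have h3 : P {w | R < ‖X (s + h) w - X s w‖} = P {w | R < ‖X h w‖} := h1.trans h2
  rw [measureReal_def, h3]
  exact hK h hh R hR

theorem measureReal_exists_grid_le [IsProbabilityMeasure P] (hX : IsLevyProcess X P)
    (hm : ∀ t, Measurable (X t)) {K : ℝ}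
    (hK : ∀ t ≤ 1, ∀ R > 0, P.real {w | R < ‖X t w‖} ≤ K / R) (s : ℝ≥0) {N : ℕ} (hN : 0 < N)
    {R : ℝ} (hR : 0 < R) :
    P.real {w | ∃ k ≤ N, 2 * R < ‖X (s + k / N) w - X s w‖} ≤ 2 * (K / R) := by
  -- Either the hypothesis of Ottaviani's inequality holds, or the claimed bound exceeds 1.
  rcases le_or_gt (K / R) (1 / 2) with hKR | hKR
  swap
  · exact measureReal_le_one.trans (by linarith)
  let τ : ℕ → ℝ≥0 := fun k => s + k / N
  have hτ : Monotone τ := fun i j hij => by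
    simp only [τ]
    gcongr
  have hN' : (N : ℝ≥0) ≠ 0 := by positivity
  have hIco : ∀ k ≤ N, ∀ w, ∑ i ∈ Finset.Ico k N, (X (τ (i + 1)) w - X (τ i) w) =
      X (τ k + ((N - k : ℕ) : ℝ≥0) / N) w - X (τ k) w := by
    intro k hk w
    have : τ k + ((N - k : ℕ) : ℝ≥0) / N = τ N := by
      simp only [τ]
      rw [add_assoc, ← add_div, ← Nat.cast_add, Nat.add_sub_cancel' hk]
    rw [this, Finset.sum_Ico_sub (fun i => X (τ i) w) hk]
  have htail : ∀ k ≤ N, P.real {w | R < ‖∑ i ∈ Finset.Ico k N,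
      (X (τ (i + 1)) w - X (τ i) w)‖} ≤ K / R := by
    intro k hk
    simp_rw [hIco k hk]
    refine hX.measureReal_lt_norm_sub_le hK _ (div_le_one_of_le₀ ?_ zero_le) hR
    exact_mod_cast Nat.sub_le N k
  have h := (hX.indep.nat hτ).ottaviani (fun i => (hm _).sub (hm _)) N
    (R := R) (fun k hk => (htail k hk).trans hKR)
  have h0 := htail 0 (Nat.zero_le _)
  rw [← Finset.range_eq_Ico] at h0
  have hrange : ∀ k w, ∑ i ∈ Finset.range k, (X (τ (i + 1)) w - X (τ i) w) =
      X (s + k / N) w - X s w := by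
    intro k w
    rw [Finset.sum_range_sub (fun i => X (τ i) w)]
    simp [τ]
  simp_rw [hrange] at h h0
  linarith

/-- Dyadic grids are nested and the grid bound does not depend on the level, so continuity from
below gives it for all levels at once. -/
theorem measure_exists_dyadic_le [IsProbabilityMeasure P] (hX : IsLevyProcess X P)
    (hm : ∀ t, Measurable (X t)) {K : ℝ}
    (hK : ∀ t ≤ 1, ∀ R > 0, P.real {w | R < ‖X t w‖} ≤ K / R) (s : ℝ≥0) {R : ℝ} (hR : 0 < R) :
    P {w | ∃ l k : ℕ, k ≤ 2 ^ l ∧ 2 * R < ‖X (s + k / 2 ^ l) w - X s w‖} ≤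
      ENNReal.ofReal (2 * (K / R)) := by
  let B : ℕ → Set Ω := fun l => {w | ∃ k : ℕ, k ≤ 2 ^ l ∧
    2 * R < ‖X (s + k / (2 ^ l : ℕ)) w - X s w‖}
  have hB : Monotone B := by
    refine monotone_nat_of_le_succ fun l w => ?_
    rintro ⟨k, hk, hw⟩
    refine ⟨2 * k, by rw [pow_succ]; omega, ?_⟩
    have : ((2 * k : ℕ) : ℝ≥0) / (2 ^ (l + 1) : ℕ) = k / (2 ^ l : ℕ) := by
      push_cast
      rw [pow_succ, mul_comm _ (2 : ℝ≥0), mul_div_mul_left _ _ two_ne_zero]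
    rwa [this]
  have hunion : {w | ∃ l k : ℕ, k ≤ 2 ^ l ∧ 2 * R < ‖X (s + k / 2 ^ l) w - X s w‖} =
      ⋃ l, B l := by
    ext w
    simp [B]
  rw [hunion, hB.measure_iUnion]
  refine iSup_le fun l => ?_
  rw [← ofReal_measureReal (μ := P)]
  exact ENNReal.ofReal_le_ofReal
    (hX.measureReal_exists_grid_le hm hK s (by positivity) hR)

end IsLevyProcess

theorem norm_sub_le_of_dyadic {E : Type*} [NormedAddCommGroup E] {x : ℝ≥0 → E}
    (hx : ∀ t, ContinuousWithinAt x (Ici t) t) {s : ℝ≥0} {R : ℝ}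
    (h : ∀ l k : ℕ, k ≤ 2 ^ l → ‖x (s + k / 2 ^ l) - x s‖ ≤ R) {u : ℝ≥0} (hu : u ≤ 1) :
    ‖x (s + u) - x s‖ ≤ R := by
  rcases hu.lt_or_eq with hu | rfl
  swap
  · simpa using h 0 1 (by simp)
  -- Dyadic approximation from the right; u < 1 keeps the numerator at most 2^l, and so u = 1 was
  -- treated separately.
  let q : ℕ → ℝ≥0 := fun l => s + ((⌊u * 2 ^ l⌋₊ + 1 : ℕ) : ℝ≥0) / 2 ^ l
  have h2 : ∀ l : ℕ, (0 : ℝ≥0) < 2 ^ l := fun l => by positivity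
  have hq1 : ∀ l, s + u ≤ q l := by
    intro l
    have := (Nat.lt_floor_add_one (u * 2 ^ l)).le
    have h3 : u ≤ ((⌊u * 2 ^ l⌋₊ + 1 : ℕ) : ℝ≥0) / 2 ^ l := by
      rw [le_div_iff₀ (h2 l)]
      exact_mod_cast this
    simp only [q]
    gcongr
  have hq2 : ∀ l, q l ≤ s + u + (1 / 2) ^ l := by
    intro l
    have := Nat.floor_le (zero_le : 0 ≤ u * 2 ^ l)
    have h3 : ((⌊u * 2 ^ l⌋₊ + 1 : ℕ) : ℝ≥0) / 2 ^ l ≤ u + (1 / 2) ^ l := by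
      rw [div_le_iff₀ (h2 l), add_mul, ← mul_pow]
      push_cast
      simpa using this
    simp only [q]
    rw [add_assoc]
    gcongr
  have hlim : Tendsto q atTop (𝓝 (s + u)) := by
    refine tendsto_of_tendsto_of_tendsto_of_le_of_le tendsto_const_nhds ?_ hq1 hq2
    have h0 : Tendsto (fun l : ℕ => ((1 / 2 : ℝ≥0)) ^ l) atTop (𝓝 0) :=
      NNReal.tendsto_pow_atTop_nhds_zero_of_lt_one (by
        rw [← NNReal.coe_lt_coe]
        norm_num)
    simpa using h0.const_add (s + u)
  have hlim' : Tendsto (fun l => x (q l)) atTop (𝓝 (x (s + u))) :=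
    (hx (s + u)).tendsto.comp
      (tendsto_nhdsWithin_of_tendsto_nhds_of_eventually_within _ hlim (.of_forall hq1))
  refine le_of_tendsto (hlim'.sub_const (x s)).norm (.of_forall fun l => h l _ ?_)
  have h3 : u * 2 ^ l < ((2 ^ l : ℕ) : ℝ≥0) := by
    push_cast
    exact mul_lt_of_lt_one_left (h2 l) hu
  exact (Nat.floor_lt' (by positivity)).2 h3

theorem exists_norm_le_mul_pow {E : Type*} [NormedAddCommGroup E] {x : ℝ≥0 → E} {q : ℝ}
    (hq : 1 < q) {n₀ : ℕ}
    (h : ∀ n : ℕ, n₀ ≤ n → ∀ u : ℝ≥0, u ≤ 1 → ‖x (n + u) - x n‖ ≤ 2 * q ^ n) :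
    ∃ C, ∀ n : ℕ, n₀ ≤ n → ∀ u : ℝ≥0, u ≤ 1 → ‖x (n + u)‖ ≤ C * q ^ n := by
  -- Then 2qⁿ + C qⁿ ≤ C qⁿ⁺¹, which closes the induction over integer times.
  set C := max ‖x n₀‖ (2 / (q - 1))
  have hq0 : 0 < q - 1 := sub_pos.2 hq
  have hC : 2 ≤ C * (q - 1) := (div_le_iff₀ hq0).1 (le_max_right _ _)
  have hC0 : 0 ≤ C := (norm_nonneg _).trans (le_max_left _ _)
  have hint : ∀ n : ℕ, n₀ ≤ n → ‖x n‖ ≤ C * q ^ n := by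
    intro n hn
    induction n, hn using Nat.le_induction with
    | base => exact (le_max_left _ _).trans (le_mul_of_one_le_right hC0 (one_le_pow₀ hq.le))
    | succ n hn ih =>
      have h1 := h n hn 1 le_rfl
      have h2 : ‖x (n + 1)‖ ≤ ‖x (n + 1) - x n‖ + ‖x n‖ := norm_le_norm_sub_add _ _
      have hqn : 0 < q ^ n := by positivity
      push_cast
      calc _ ≤ 2 * q ^ n + C * q ^ n := h2.trans (add_le_add h1 ih)
        _ ≤ C * (q - 1) * q ^ n + C * q ^ n := by gcongr
        _ = _ := by ring
  refine ⟨2 + C, fun n hn u hu => ?_⟩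
  calc ‖x (n + u)‖ ≤ ‖x (n + u) - x n‖ + ‖x n‖ := norm_le_norm_sub_add _ _
    _ ≤ 2 * q ^ n + C * q ^ n := add_le_add (h n hn u hu) (hint n hn)
    _ = _ := by ring

theorem IsLevyProcess.ae_exists_norm_le_exp [IsProbabilityMeasure P]
    (hX : IsLevyProcess X P) (hm : ∀ t, Measurable (X t))
    {K : ℝ} (hK : ∀ t ≤ 1, ∀ R > 0, P.real {w | R < ‖X t w‖} ≤ K / R) {ε : ℝ} (hε : 0 < ε) :
    ∀ᵐ w ∂P, ∃ C, ∀ᶠ t : ℝ≥0 in atTop, ‖X t w‖ ≤ C * Real.exp (ε * t) := by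
  set q := Real.exp ε with hq_def
  have hq : 1 < q := Real.one_lt_exp_iff.2 hε
  have hq0 : 0 < q := Real.exp_pos ε
  -- Borel–Cantelli with R = qⁿ: the weak tail K/R is already summable along a geometric sequence.
  have hsum : ∑' n : ℕ, P {w | ∃ l k : ℕ, k ≤ 2 ^ l ∧
      2 * q ^ n < ‖X (n + k / 2 ^ l) w - X n w‖} ≠ ∞ := by
    refine ne_top_of_le_ne_top ?_ (ENNReal.tsum_le_tsum fun n : ℕ =>
      hX.measure_exists_dyadic_le hm hK n (pow_pos hq0 n))
    have hs : Summable fun n : ℕ => 2 * (K / q ^ n) := by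
      have := (summable_geometric_of_lt_one (inv_nonneg.2 hq0.le) (inv_lt_one_of_one_lt₀
        hq)).mul_left (2 * K)
      refine this.congr fun n => ?_
      rw [inv_pow, mul_assoc, div_eq_mul_inv]
    exact hs.tsum_ofReal_ne_top
  filter_upwards [ae_eventually_notMem hsum, hX.cadlag] with w hw hcad
  obtain ⟨n₀, hn₀⟩ := eventually_atTop.1 hw
  obtain ⟨C, hC⟩ := exists_norm_le_mul_pow (x := fun t => X t w) hq (n₀ := n₀) fun n hn u hu => by
    refine norm_sub_le_of_dyadic (fun t => (hcad t).1) (fun l k hk => ?_) hu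
    by_contra hcon
    exact hn₀ n hn ⟨l, k, hk, not_le.1 hcon⟩
  have hC0 : 0 ≤ C := by
    have := (norm_nonneg _).trans (hC n₀ le_rfl 0 zero_le)
    exact nonneg_of_mul_nonneg_left this (by positivity)
  refine ⟨C, eventually_atTop.2 ⟨n₀, fun t ht => ?_⟩⟩
  have hfl : (⌊t⌋₊ : ℝ≥0) ≤ t := Nat.floor_le zero_le
  have h1 := hC ⌊t⌋₊ (Nat.le_floor ht) (t - ⌊t⌋₊)
    (tsub_le_iff_left.2 (Nat.lt_floor_add_one t).le)
  rw [add_tsub_cancel_of_le hfl] at h1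
  refine h1.trans (mul_le_mul_of_nonneg_left ?_ hC0)
  rw [hq_def, ← Real.exp_nat_mul, mul_comm]
  have : ((⌊t⌋₊ : ℕ) : ℝ) ≤ t := by exact_mod_cast hfl
  gcongr

end Growth

/-! ### The two-sided canonical process -/

theorem measurable_canonicalProcess {m : ℕ} (t : ℝ) :
    Measurable (canonicalProcess (m := m) t) :=
  (measurable_pi_apply t).comp measurable_subtype_coe

theorem ae_isSlowlyGrowing {m k : ℕ} {δ : ℝ} (hδ1 : δ < 1) {μ : ℝ} (hμ : 0 < μ)
    {b : EuclideanSpace ℝ (Fin m)} {A : Matrix (Fin m) (Fin k) ℝ}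
    {ν : Measure (EuclideanSpace ℝ (Fin m))} {P : Measure (PathSpace m)} [IsProbabilityMeasure P]
    (hX : IsSmallJumpLevyProcess δ b A ν
      (fun (t : ℝ≥0) (w : PathSpace m) => canonicalProcess (-(t : ℝ)) w) P) :
    ∀ᵐ w ∂P, IsSlowlyGrowing μ w.1 := by
  obtain ⟨K, -, hK⟩ := hX.exists_tail_le hδ1
  filter_upwards [hX.isLevyProcess.ae_exists_norm_le_exp
    (fun t => measurable_canonicalProcess _) hK (half_pos hμ)] with w hw
  obtain ⟨C, hC⟩ := hw
  refine ⟨w.2.isRegulated, μ / 2, C, (half_pos hμ).le, half_lt_self hμ, ?_⟩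
  filter_upwards [(tendsto_real_toNNReal_atTop.comp tendsto_neg_atBot_atTop).eventually hC,
    eventually_le_atBot 0] with s hs hs0
  simp only [Function.comp_apply, Real.coe_toNNReal _ (neg_nonneg.2 hs0), neg_neg,
    mul_neg] at hs
  exact hs

/-! ### Pathwise integrals as limits in probability -/

theorem TaggedPartition.measurable_sum {m : ℕ} {a b : ℝ} (π : TaggedPartition a b) (f : ℝ → ℝ) :
    Measurable fun w : PathSpace m => π.sum f w.1 := by
  unfold TaggedPartition.sum
  have h : ∀ t, Measurable fun w : PathSpace m => w.1 t := measurable_canonicalProcess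
  refine Finset.measurable_fun_sum _ fun i _ => ?_
  have h2 : Measurable fun w : PathSpace m => w.1 (π.pts (i + 1)) - w.1 (π.pts i) :=
    (h _).sub (h _)
  exact h2.const_smul (f (π.tags i))

theorem HasStieltjesIntegral.tendsto_sum {m : ℕ} {f : ℝ → ℝ} {g : ℝ → EuclideanSpace ℝ (Fin m)}
    {a b : ℝ} {I : EuclideanSpace ℝ (Fin m)} (hI : HasStieltjesIntegral f g a b I)
    {π : ℕ → TaggedPartition a b} (hπ : ∀ η > 0, ∀ᶠ n in atTop, (π n).MeshLE η) :
    Tendsto (fun n => (π n).sum f g) atTop (𝓝 I) := by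
  rw [Metric.tendsto_nhds]
  intro ε hε
  obtain ⟨η, hη, h⟩ := hI ε hε
  filter_upwards [hπ η hη] with n hn
  rw [dist_eq_norm]
  exact h _ hn

theorem exists_seq_taggedPartition {a b : ℝ} (hab : a ≤ b) :
    ∃ π : ℕ → TaggedPartition a b, ∀ η > 0, ∀ᶠ n in atTop, (π n).MeshLE η := by
  choose π hπ using fun n : ℕ =>
    exists_taggedPartition_meshLE hab (η := 1 / ((n : ℝ) + 1)) (by positivity)
  refine ⟨π, fun η hη => ?_⟩
  filter_upwards [tendsto_one_div_add_atTop_nhds_zero_nat.eventually_lt_const hη] with n hn i hi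
  exact (hπ n i hi).trans hn.le

theorem aestronglyMeasurable_of_hasStieltjesIntegral {m : ℕ} {P : Measure (PathSpace m)}
    {f : ℝ → ℝ} {a b : ℝ} (hab : a ≤ b) {I : PathSpace m → EuclideanSpace ℝ (Fin m)}
    (hI : ∀ w : PathSpace m, HasStieltjesIntegral f w.1 a b (I w)) :
    AEStronglyMeasurable I P := by
  obtain ⟨π, hπ⟩ := exists_seq_taggedPartition hab
  have hm : ∀ n, AEStronglyMeasurable (fun w : PathSpace m => (π n).sum f w.1) P := fun n =>
    ((π n).measurable_sum f).aestronglyMeasurable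
  exact aestronglyMeasurable_of_tendsto_ae atTop hm (ae_of_all _ fun w => (hI w).tendsto_sum hπ)

theorem isStochasticIntegral_of_hasStieltjesIntegral {m : ℕ} {P : Measure (PathSpace m)}
    [IsFiniteMeasure P] {f : ℝ → ℝ} {a b : ℝ} {I : PathSpace m → EuclideanSpace ℝ (Fin m)}
    (hI : ∀ w : PathSpace m, HasStieltjesIntegral f w.1 a b (I w)) :
    IsStochasticIntegral P f canonicalProcess a b I := by
  intro π hπ
  exact tendstoInMeasure_of_tendsto_ae (fun n => ((π n).measurable_sum f).aestronglyMeasurable)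
    (ae_of_all _ fun w => (hI w).tendsto_sum hπ)

theorem isStochasticIntegralFromBot_integralFromBot {m : ℕ} {P : Measure (PathSpace m)}
    [IsFiniteMeasure P] {μ : ℝ} (h : ∀ᵐ w ∂P, IsSlowlyGrowing μ w.1) (t : ℝ) :
    IsStochasticIntegralFromBot P (fun s => Real.exp (μ * s)) canonicalProcess t
      (fun w => integralFromBot (fun s => Real.exp (μ * s)) w.1 t) := by
  -- On [a, t] the integral exists for every path; only the limit a → -∞ needs the growth bound. The
  -- value 0 for a > t just makes every J a measurable.
  let J : ℝ → PathSpace m → EuclideanSpace ℝ (Fin m) := fun a w => if a ≤ t then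
    Real.exp (μ * t) • w.1 t - Real.exp (μ * a) • w.1 a
      - ∫ s in a..t, (μ * Real.exp (μ * s)) • w.1 s else 0
  have hJ : ∀ a ≤ t, ∀ w : PathSpace m,
      HasStieltjesIntegral (fun s => Real.exp (μ * s)) w.1 a t (J a w) := by
    intro a ha w
    simp only [J, if_pos ha]
    exact w.2.isRegulated.hasStieltjesIntegral (hasDerivAt_exp_const_mul μ)
      (continuous_mul_exp_const_mul μ) a t
  have hmeas : ∀ a, AEStronglyMeasurable (J a) P := by
    intro a
    by_cases ha : a ≤ t
    · exact aestronglyMeasurable_of_hasStieltjesIntegral ha (hJ a ha)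
    · simp only [J, if_neg ha]
      exact aestronglyMeasurable_const
  refine ⟨J, fun a ha => isStochasticIntegral_of_hasStieltjesIntegral (hJ a ha), fun ε hε => ?_⟩
  -- Almost sure convergence implies convergence in measure for sequences, so a → -∞ is tested along
  -- sequences.
  refine tendsto_of_seq_tendsto fun u hu => ?_
  refine tendstoInMeasure_of_tendsto_ae (f := fun n => J (u n)) (fun n => hmeas (u n)) ?_ ε hε
  filter_upwards [h] with w hw
  rw [hw.integralFromBot_eq]
  refine ((hw.tendsto_integral t).comp hu).congr' ?_
  filter_upwards [hu.eventually (eventually_le_atBot t)] with n hn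
  simp only [J, if_pos hn, Function.comp_apply]

/-- `canonicalProcess` is, under `P`, the two-sided Lévy process with small jumps; the first two
conjuncts say that `Z` is well defined, pathwise and as a stochastic integral, the third is
`dZ = -μ Z dt + dL`, and the last is `Z_{s+t}(w) = Z_t(θ_s w)`. -/
theorem mainTheorem8 (m : ℕ) (δ : ℝ) (hδ0 : 0 < δ) (hδ1 : δ < 1) (μ : ℝ) (hμ : 0 < μ)
    (k k' : ℕ) (b b' : EuclideanSpace ℝ (Fin m))
    (A : Matrix (Fin m) (Fin k) ℝ) (A' : Matrix (Fin m) (Fin k') ℝ)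
    (ν ν' : Measure (EuclideanSpace ℝ (Fin m)))
    (P : Measure (PathSpace m)) [IsProbabilityMeasure P]
    (hpos : IsSmallJumpLevyProcess δ b A ν
      (fun (t : ℝ≥0) (w : PathSpace m) => canonicalProcess (t : ℝ) w) P)
    (hneg : IsSmallJumpLevyProcess δ b' A' ν'
      (fun (t : ℝ≥0) (w : PathSpace m) => canonicalProcess (-(t : ℝ)) w) P) :
    (∀ᵐ w ∂P, ∀ t : ℝ, HasIntegralFromBot (fun s => Real.exp (μ * s)) w.1 t
        (integralFromBot (fun s => Real.exp (μ * s)) w.1 t)) ∧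
    (∀ t : ℝ, IsStochasticIntegralFromBot P (fun s => Real.exp (μ * s)) canonicalProcess t
        (fun w => integralFromBot (fun s => Real.exp (μ * s)) w.1 t)) ∧
    (∀ᵐ w ∂P, ∀ s t : ℝ, s ≤ t →
        IntervalIntegrable (fun r => ouProcess μ r w.1) volume s t ∧
        ouProcess μ t w.1 - ouProcess μ s w.1 =
          -μ • (∫ r in s..t, ouProcess μ r w.1) +
            (canonicalProcess t w - canonicalProcess s w)) ∧
    (∀ᵐ w ∂P, ∀ s t : ℝ,
        HasIntegralFromBot (fun r => Real.exp (μ * r)) (wienerShift s w.1) t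
          (integralFromBot (fun r => Real.exp (μ * r)) (wienerShift s w.1) t) ∧
        ouProcess μ (s + t) w.1 = ouProcess μ t (wienerShift s w.1)) := by
  have h := ae_isSlowlyGrowing hδ1 hμ hneg
  refine ⟨h.mono fun w hw t => hw.hasIntegralFromBot_integralFromBot t,
    isStochasticIntegralFromBot_integralFromBot h,
    h.mono fun w hw s t _ => ⟨hw.intervalIntegrable_ouProcess s t, hw.ouProcess_sub s t⟩,
    h.mono fun w hw s t =>
      ⟨(hw.wienerShift s).hasIntegralFromBot_integralFromBot t, hw.ouProcess_add s t⟩⟩
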